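/- **Theorem 2.1.** Let $d\ge 3$. Let $W_+$ (resp. $W$) be the space of nearest-neighbor paths $w:\mathbb N\to\mathbb Z^d$ (resp. $w:\mathbb Z\to\mathbb Z^d$) with $|w(n)|\to\infty$ as $n\to\infty$ (resp. as $|n|\to\infty$), with the $\sigma$-field generated by the coordinates $X_n$, and let $W^*$ be the quotient of $W$ by time shifts, with projection $\pi^*$ and the largest $\sigma$-field making $\pi^*$ measurable. Let $P_x$ be the law on $W_+$ of simple random walk started at $x$. For finite $K\subset\mathbb Z^d$ put $e_K(x)=P_x[X_n\notin K \text{ for all } n\ge 1]$ if $x\in K$ and $e_K(x)=0$ otherwise, let $Q_K$ be the finite measure on $W$ such that $Q_K[X_0=x]=e_K(x)$ and, given $X_0=x$, the sequences $(X_n)_{n\ge0}$ and $(X_{-n})_{n\ge0}$ are independent with laws $P_x$ and $P_x[\,\cdot\mid X_n\notin K \text{ for all } n\ge1]$, and let $W_K^*\subset W^*$ be the set of classes of trajectories that visit $K$. Let $\nu$ be the unique $\sigma$-finite measure on $W^*$ with $1_{W^*_K}\nu=\pi^*\circ Q_K$ (image measure) for every finite $K$; it is obtained by patching together the consistent measures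 $\pi^*\circ Q_K$. Let $\Omega$ be the space of point measures $\omega=\sum_{i\ge0}\delta_{(w_i^*,u_i)}$ on $W^*\times\mathbb R_+$ with $\omega(W_K^*\times[0,u])<\infty$ for all finite $K$ and all $u\ge0$, with the $\sigma$-field generated by the evaluations $\omega\mapsto\omega(D)$ for measurable $D$, and let $\mathbb P$ be the law on $\Omega$ of the Poisson point process with intensity $\nu(dw^*)\,du$. For $u\ge0$ let $\mathcal I^u(\omega)=\bigcup_{u_i\le u}\mathrm{range}(w_i^*)$ and $\mathcal V^u=\mathbb Z^d\setminus\mathcal I^u$. Let $Q_u$ be the law under $\mathbb P$ of the (measurable) configuration $(1\{x\in\mathcal V^u\})_{x\in\mathbb Z^d}$ on $\{0,1\}^{\mathbb Z^d}$ with its product $\sigma$-field, and let $(t_xy)(z)=y(z+x)$ for $x,z\in\mathbb Z^d$ and $y\in\{0,1\}^{\mathbb Z^d}$. Then for every $u\ge0$: 1. $(t_x)_{x\in\mathbb Z^d}$ is a measure-preserving flow on $(\{0,1\}^{\mathbb Z^d},Q_u)$, and it is ergodic: every measurable set invariant under all $t_x$ has $Q_u$-probability $0$ or $1$. 2. The event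 $\mathrm{Perc}(u)$ that $\mathcal V^u$ (as a subset of the nearest-neighbor lattice) contains an infinite connected component is measurable and satisfies $\mathbb P[\mathrm{Perc}(u)]\in\{0,1\}$. -/

import Mathlib

open MeasureTheory ProbabilityTheory Filter Set
open scoped NNReal ENNReal

namespace Interlacement

noncomputable section

/-! ### The lattice and its trajectories -/

/-- The vertex set of the integer lattice of dimension `d`. -/
abbrev Lattice (d : ℕ) : Type := Fin d → ℤ

/-- Two sites are neighbors when their Euclidean distance is one. -/
def IsNeighbor {d : ℕ} (x y : Lattice d) : Prop := ∑ i, (x i - y i) ^ 2 = 1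

/-- The nearest-neighbor graph on the lattice. -/
def latticeGraph (d : ℕ) : SimpleGraph (Lattice d) where
  Adj x y := IsNeighbor x y
  symm := ⟨fun x y h => by
    have e : ∀ i, (y i - x i) ^ 2 = (x i - y i) ^ 2 := fun i => by ring
    simpa only [IsNeighbor, e] using h⟩
  loopless := ⟨fun x h => by simp [IsNeighbor] at h⟩

/-- The set of one-sided infinite nearest-neighbor paths tending to infinity. Tending to infinity
is expressed by saying that the path is eventually outside of every finite set of sites. -/
def wPlusSet (d : ℕ) : Set (ℕ → Lattice d) :=
  {w | (∀ n, IsNeighbor (w (n + 1)) (w n)) ∧ Tendsto w atTop cofinite}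

/-- The set of doubly infinite nearest-neighbor paths `w` such that `w n` tends to infinity when
`|n|` tends to infinity. -/
def wSet (d : ℕ) : Set (ℤ → Lattice d) :=
  {w | (∀ n, IsNeighbor (w (n + 1)) (w n)) ∧ Tendsto w cofinite cofinite}

/-- Tending to infinity, spelled out through countably many coordinates. -/
theorem tendsto_cofinite_iff {ι : Type} {d : ℕ} (w : ι → Lattice d) :
    Tendsto w cofinite cofinite ↔
      ∀ x : Lattice d, ∃ F : Finset ι, ∀ n, n ∉ F → w n ≠ x := by
  constructor
  · intro h x
    have hx : (w ⁻¹' {x}).Finite := by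
      have := h (Set.finite_singleton x).compl_mem_cofinite
      simpa [Filter.mem_map, mem_cofinite] using this
    exact ⟨hx.toFinset, fun n hn => by simpa using hn⟩
  · intro h s hs
    rw [Filter.mem_map, mem_cofinite, ← preimage_compl, ← biUnion_preimage_singleton]
    refine Set.Finite.biUnion hs fun x _ => ?_
    obtain ⟨F, hF⟩ := h x
    exact F.finite_toSet.subset fun n hn => by_contra fun h' => hF n h' hn

theorem measurableSet_trajectories {ι : Type} [Countable ι] (d : ℕ) (s : ι → ι) :
    MeasurableSet {w : ι → Lattice d |
      (∀ n, IsNeighbor (w (s n)) (w n)) ∧ Tendsto w cofinite cofinite} := by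
  simp only [tendsto_cofinite_iff]
  refine MeasurableSet.inter (s₁ := {w : ι → Lattice d | ∀ n, IsNeighbor (w (s n)) (w n)})
    ?_ (?_ : MeasurableSet {w : ι → Lattice d |
      ∀ x : Lattice d, ∃ F : Finset ι, ∀ n, n ∉ F → w n ≠ x})
  · have h : MeasurableSet {p : Lattice d × Lattice d | IsNeighbor p.1 p.2} :=
      MeasurableSet.of_discrete
    have : {w : ι → Lattice d | ∀ n, IsNeighbor (w (s n)) (w n)} =
        ⋂ n, (fun w => (w (s n), w n)) ⁻¹' {p | IsNeighbor p.1 p.2} := by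
      ext w; simp
    rw [this]
    exact MeasurableSet.iInter fun n =>
      ((measurable_pi_apply _).prodMk (measurable_pi_apply _)) h
  · have : {w : ι → Lattice d | ∀ x : Lattice d, ∃ F : Finset ι, ∀ n, n ∉ F → w n ≠ x} =
        ⋂ x : Lattice d, ⋃ F : Finset ι, ⋂ n : ι, ⋂ (_ : n ∉ F), (fun w => w n) ⁻¹' {x}ᶜ := by
      ext w; simp
    rw [this]
    exact MeasurableSet.iInter fun x => MeasurableSet.iUnion fun F => MeasurableSet.iInter fun n =>
      MeasurableSet.iInter fun _ => (measurable_pi_apply n) (measurableSet_singleton x).compl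

theorem measurableSet_wSet (d : ℕ) : MeasurableSet (wSet d) :=
  measurableSet_trajectories d fun n => n + 1

theorem measurableSet_wPlusSet (d : ℕ) : MeasurableSet (wPlusSet d) := by
  unfold wPlusSet
  rw [← Nat.cofinite_eq_atTop]
  exact measurableSet_trajectories d fun n => n + 1

/-- The space `W₊`, with the sigma-field generated by the coordinates. -/
abbrev WPlus (d : ℕ) : Type := wPlusSet d

/-- The space `W`, with the sigma-field generated by the coordinates. -/
abbrev W (d : ℕ) : Type := wSet d

/-- Equality of doubly infinite trajectories up to a time shift. -/
def shiftSetoid (d : ℕ) : Setoid (W d) where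
  r w w' := ∃ k : ℤ, ∀ n : ℤ, w.1 n = w'.1 (n + k)
  iseqv :=
    { refl := fun w => ⟨0, fun n => by simp⟩
      symm := fun {w w'} ⟨k, hk⟩ => ⟨-k, fun n => by
        have := hk (n + -k)
        simpa using this.symm⟩
      trans := fun {w w' w''} ⟨k, hk⟩ ⟨l, hl⟩ => ⟨k + l, fun n => by
        rw [hk, hl, add_assoc]⟩ }

/-- The space `W*` of doubly infinite trajectories modulo time shift. -/
def WStar (d : ℕ) : Type := Quotient (shiftSetoid d)

/-- The canonical projection from `W` to `W*`. -/
def proj {d : ℕ} (w : W d) : WStar d := Quotient.mk (shiftSetoid d) w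

/-- The largest sigma-field on `W*` making the canonical projection measurable. -/
instance (d : ℕ) : MeasurableSpace (WStar d) := MeasurableSpace.map proj inferInstance

theorem measurable_proj (d : ℕ) : Measurable (proj : W d → WStar d) := fun _ hs => hs

instance (d : ℕ) : MeasurableSingletonClass (WStar d) := ⟨fun a => by
  obtain ⟨w, rfl⟩ := Quotient.exists_rep a
  change MeasurableSet ((proj : W d → WStar d) ⁻¹' _)
  have : (proj ⁻¹' {(Quotient.mk (shiftSetoid d) w : WStar d)} : Set (W d)).Countable := by
    have : (proj ⁻¹' {(Quotient.mk (shiftSetoid d) w : WStar d)} : Set (W d)) ⊆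
        Subtype.val ⁻¹' (Set.range (fun k : ℤ => fun n : ℤ => w.1 (n + k))) := by
      intro w' h
      obtain ⟨k, hk⟩ := Quotient.exact h
      exact ⟨k, funext fun n => (hk n).symm⟩
    exact ((Set.countable_range _).preimage Subtype.val_injective).mono this
  exact this.measurableSet⟩

/-- The set of sites visited by a trajectory modulo time shift. -/
def WStar.range {d : ℕ} (ws : WStar d) : Set (Lattice d) :=
  {x | ∃ w : W d, proj w = ws ∧ ∃ n : ℤ, w.1 n = x}

/-- The set of trajectories modulo time shift that enter the finite set `K`. -/
def wStarHit {d : ℕ} (K : Finset (Lattice d)) : Set (WStar d) :=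
  proj '' {w : W d | ∃ n : ℤ, w.1 n ∈ K}

/-! ### Simple random walk and the equilibrium measure -/

/-- The `2 d` unit vectors of the lattice. -/
def unitVec {d : ℕ} (s : Fin d × Bool) : Lattice d :=
  if s.2 then Pi.single s.1 1 else -Pi.single s.1 1

/-- The uniform distribution on the `2 d` unit vectors. -/
def stepLaw (d : ℕ) [NeZero d] : Measure (Lattice d) :=
  ((PMF.uniformOfFintype (Fin d × Bool)).map unitVec).toMeasure

instance (d : ℕ) [NeZero d] : IsProbabilityMeasure (stepLaw d) := by
  unfold stepLaw; infer_instance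

/-- The path started at `x` with the given sequence of increments. -/
def pathOfSteps {d : ℕ} (x : Lattice d) (ξ : ℕ → Lattice d) : ℕ → Lattice d :=
  fun n => x + ∑ k ∈ Finset.range n, ξ k

theorem measurable_pathOfSteps {d : ℕ} (x : Lattice d) : Measurable (pathOfSteps x) := by
  unfold pathOfSteps
  fun_prop

/-- The canonical law of simple random walk started at `x`, on the space of all sequences. -/
def walkLaw {d : ℕ} [NeZero d] (x : Lattice d) : Measure (ℕ → Lattice d) :=
  (Measure.infinitePi fun _ : ℕ => stepLaw d).map (pathOfSteps x)

/-- The law `P_x`: the restriction to `W₊` of the canonical law of simple random walk. -/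
def srw {d : ℕ} [NeZero d] (x : Lattice d) : Measure (WPlus d) :=
  (walkLaw x).comap Subtype.val

/-- The event that the walk does not visit `K` at any time `n ≥ 1`. -/
def noReturn {d : ℕ} (K : Finset (Lattice d)) : Set (WPlus d) :=
  {w | ∀ n : ℕ, 1 ≤ n → w.1 n ∉ K}

/-- The density `e_K` of the equilibrium measure of `K`. -/
def equilibrium {d : ℕ} [NeZero d] (K : Finset (Lattice d)) (x : Lattice d) : ℝ≥0∞ :=
  if x ∈ K then srw x (noReturn K) else 0

/-! ### The intensity measure of the interlacement -/

/-- The doubly infinite sequence which follows `p.2` in positive time and `p.1` in negative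
time. -/
def glue {d : ℕ} (p : WPlus d × WPlus d) : ℤ → Lattice d :=
  fun n => if 0 ≤ n then p.2.1 n.toNat else p.1.1 (-n).toNat

theorem measurable_glue (d : ℕ) : Measurable (glue : WPlus d × WPlus d → ℤ → Lattice d) := by
  refine measurable_pi_lambda _ fun n => ?_
  unfold glue
  split_ifs
  · exact (measurable_pi_apply _).comp (measurable_subtype_coe.comp measurable_snd)
  · exact (measurable_pi_apply _).comp (measurable_subtype_coe.comp measurable_fst)

/-- The finite measure `Q_K` on `W`: the position at time `0` has distribution `e_K`, and given
that it equals `x`, the future and the past are independent, the future being distributed as `P_x`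
and the (time-reversed) past as `P_x` conditioned on never returning to `K`. -/
def entranceMeasure {d : ℕ} [NeZero d] (K : Finset (Lattice d)) : Measure (W d) :=
  (∑ x ∈ K, equilibrium K x •
    (((srw x)[|noReturn K]).prod (srw x)).map glue).comap Subtype.val

/-- The intensity measure `ν` on `W*`. The images of the measures `Q_K` under the projection are
consistent: for `K ⊆ K'` the one for `K` is the restriction to `wStarHit K` of the one for `K'`.
In particular they increase with `K`, and `ν`, which is obtained by patching them together,
is their supremum in the lattice of measures. -/
def intensity (d : ℕ) [NeZero d] : Measure (WStar d) :=
  ⨆ K : Finset (Lattice d), (entranceMeasure K).map proj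

/-! ### Poisson point processes and the canonical space -/

/-- Under `P`, the random measure `N` is a Poisson point process with intensity measure `m` (a
sigma-finite measure): the numbers of points in disjoint sets are independent, and the number of
points in a set of finite intensity has the Poisson distribution. -/
structure IsPoissonProcess {Ω E : Type*} [MeasurableSpace Ω] [MeasurableSpace E]
    (P : Measure Ω) (N : Ω → Measure E) (m : Measure E) : Prop where
  measurable : Measurable N
  isProbabilityMeasure : IsProbabilityMeasure P
  poisson : ∀ D : Set E, MeasurableSet D → m D ≠ ∞ →
    P.map (fun ω => N ω D) = (poissonMeasure (m D).toNNReal).map (fun k : ℕ => (k : ℝ≥0∞))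
  indep : ∀ (n : ℕ) (D : Fin n → Set E), (∀ i, MeasurableSet (D i)) →
    Pairwise (fun i j => Disjoint (D i) (D j)) → iIndepFun (fun i ω => N ω (D i)) P

/-- The canonical space `Ω` of point measures `∑ i, δ_(w*_i, u_i)` on `W* × ℝ₊` giving finite mass
to the trajectories with label at most `u` that enter `K`, for every `u` and every finite `K`. -/
def pointMeasures (d : ℕ) : Set (Measure (WStar d × ℝ≥0)) :=
  {ω | (∃ p : ℕ → WStar d × ℝ≥0, ω = Measure.sum fun i => Measure.dirac (p i)) ∧
    ∀ (K : Finset (Lattice d)) (u : ℝ≥0), ω (wStarHit K ×ˢ Iic u) < ∞}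

/-- The canonical space of point measures, with the sigma-field generated by the evaluation maps
`ω ↦ ω D`, for `D` measurable. -/
abbrev PointSpace (d : ℕ) : Type := pointMeasures d

/-- Lebesgue measure `du` on the half-line of nonnegative reals. -/
def lebesgueNN : Measure ℝ≥0 := (volume : Measure ℝ).comap NNReal.toReal

/-- `P` is the law of the random interlacements: the law on the canonical space of a Poisson point
process on `W* × ℝ₊` with intensity `ν(dw*) du`. -/
def IsInterlacementLaw {d : ℕ} [NeZero d] (P : Measure (PointSpace d)) : Prop :=
  IsPoissonProcess P (fun ω => ω.1) ((intensity d).prod lebesgueNN)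

/-! ### Interlacement set, vacant set and percolation -/

/-- The interlacement at level `u`: the union of the ranges of the trajectories with label at
most `u` in the point measure `ω`. -/
def interlacementSet {d : ℕ} (u : ℝ≥0) (ω : PointSpace d) : Set (Lattice d) :=
  {x | ∃ (ws : WStar d) (t : ℝ≥0), ω.1 {(ws, t)} ≠ 0 ∧ t ≤ u ∧ x ∈ ws.range}

/-- The points of a point measure are its atoms: for any enumeration of the points of `ω`, the
interlacement set is the union of the ranges of those with label at most `u`. -/
theorem interlacementSet_eq {d : ℕ} (u : ℝ≥0) (ω : PointSpace d) (p : ℕ → WStar d × ℝ≥0)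
    (hp : ω.1 = Measure.sum fun i => Measure.dirac (p i)) :
    interlacementSet u ω = ⋃ i, ⋃ (_ : (p i).2 ≤ u), (p i).1.range := by
  ext x
  simp only [interlacementSet, mem_ofPred_eq, mem_iUnion, hp]
  constructor
  · rintro ⟨ws, t, h, ht, hx⟩
    rw [Measure.sum_apply _ (measurableSet_singleton _)] at h
    obtain ⟨i, hi⟩ : ∃ i, Measure.dirac (p i) {(ws, t)} ≠ 0 := by
      by_contra hh; push Not at hh; simp [hh] at h
    have hi' : p i = (ws, t) := by
      by_contra hne; exact hi (by simp [hne])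
    exact ⟨i, by simp [hi', ht], by simp [hi', hx]⟩
  · rintro ⟨i, hi, hx⟩
    refine ⟨(p i).1, (p i).2, ?_, hi, hx⟩
    rw [Measure.sum_apply _ (measurableSet_singleton _)]
    intro h
    have := (ENNReal.tsum_eq_zero.1 h) i
    simp at this

/-- The vacant set at level `u`. -/
def vacantSet {d : ℕ} (u : ℝ≥0) (ω : PointSpace d) : Set (Lattice d) :=
  (interlacementSet u ω)ᶜ

/-- The space `{0,1}^(ℤ^d)` of configurations. -/
def Config (d : ℕ) : Type := Lattice d → Bool

/-- The canonical product sigma-field on the space of configurations. -/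
instance (d : ℕ) : MeasurableSpace (Config d) :=
  inferInstanceAs (MeasurableSpace (Lattice d → Bool))

/-- The canonical shifts: `(t_x y) z = y (z + x)`. They form a flow indexed by the lattice. -/
instance (d : ℕ) : AddAction (Lattice d) (Config d) where
  vadd x y := fun z => y (z + x)
  zero_vadd y := funext fun z => congrArg y (add_zero z)
  add_vadd x x' y := funext fun z => congrArg y (by
    change z + (x + x') = z + x + x'
    rw [add_assoc])

open Classical in
/-- The configuration of vacant sites: it has the value `true` (one) at the vacant sites. -/
def vacantConfig {d : ℕ} (u : ℝ≥0) (ω : PointSpace d) : Config d :=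
  fun x => decide (x ∈ vacantSet u ω)

/-- The law `Q_u` of the configuration of vacant sites. -/
def vacantLaw {d : ℕ} (P : Measure (PointSpace d)) (u : ℝ≥0) : Measure (Config d) :=
  P.map (vacantConfig u)

/-- The event that the vacant set at level `u` contains an infinite connected component. -/
def perc (d : ℕ) (u : ℝ≥0) : Set (PointSpace d) :=
  {ω | ∃ C : ((latticeGraph d).induce (vacantSet u ω)).ConnectedComponent, C.supp.Infinite}

end

end Interlacement

/-!
# Ergodicity of the vacant set of random interlacements

The law of the vacant set at level `u` is determined by the probabilities that finite sets `K` are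
vacant. The set `K` is vacant when no trajectory with label at most `u` visits it, so by the Poisson
property this probability is `exp (-u * cap K)`, where the capacity `cap K = ν(W*_K)` is the
intensity of the trajectories visiting `K` (`vacantLaw_real_vacantCylinder`). Invariance under
translations is that of the capacity. Ergodicity follows from mixing, and mixing for cylinders
(which extends to all measurable sets by `tendsto_measure_inter_of_generateFrom`) amounts to
`ν(W*_K ∩ W*_{L+z}) → 0` as `z → ∞`, because
`cap (K ∪ (L + z)) = cap K + cap L - ν(W*_K ∩ W*_{L+z})`.
The percolation event is measurable and invariant under shifts of the configuration, so that its
probability is zero or one by ergodicity.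

To compute with `ν`, consider the measure `twoSidedLaw` on doubly infinite sequences: the two-sided
simple random walk whose position at time zero is distributed as the counting measure. By
reversibility it is invariant under time shifts (`measurePreserving_timeShift_one`), and `Q_K` is
its restriction to the transient trajectories visiting `K` for the first time at time zero
(`entranceMeasure_apply`). The consistency of the measures `Q_K` modulo time shift is therefore a
consequence of stationarity: a trajectory visiting `K ⊆ L` may be recentred from its first visit to
`L` to its first visit to `K` (`measure_inter_firstVisit_of_subset`). It follows that `ν` restricted
to `W*_K` is the image of the finite measure `Q_K` (`intensity_inter_wStarHit`).

A trajectory under `Q_K` visits `L + z` with a probability controlled by the probabilities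
that simple random walk started in `K` hits a point of `L + z`. In dimension at least three these
tend to zero: the function `(|x|² + 256) ^ (-1/4)` is superharmonic (`sum_lyapunov_le`), so up to a
constant it dominates the hitting probability of the origin, and it vanishes at infinity.
-/

namespace Interlacement

/-! ### Configurations: cylinders, mixing and ergodicity -/

/-- The event that all sites of the finite set `K` have the value `true`. -/
def vacantCylinder {d : ℕ} (K : Finset (Lattice d)) : Set (Config d) := {y | ∀ z ∈ K, y z = true}

theorem measurable_config_apply {d : ℕ} (z : Lattice d) : Measurable fun y : Config d => y z :=
  measurable_pi_apply (X := fun _ : Lattice d => Bool) z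

theorem measurableSet_site {d : ℕ} (z : Lattice d) : MeasurableSet {y : Config d | y z = true} :=
  measurable_config_apply z (measurableSet_singleton true)

theorem measurableSet_vacantCylinder {d : ℕ} (K : Finset (Lattice d)) :
    MeasurableSet (vacantCylinder K) := by
  have : vacantCylinder K = ⋂ z ∈ K, {y : Config d | y z = true} := by
    ext y; simp [vacantCylinder]
  rw [this]
  exact MeasurableSet.biInter K.countable_toSet fun z _ => measurableSet_site z

open scoped Classical in
theorem vacantCylinder_inter {d : ℕ} (K L : Finset (Lattice d)) :
    vacantCylinder K ∩ vacantCylinder L = vacantCylinder (K ∪ L) := by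
  ext y
  simp only [vacantCylinder, mem_inter_iff, mem_ofPred_eq, Finset.mem_union]
  grind

theorem isPiSystem_vacantCylinder (d : ℕ) :
    IsPiSystem (range (vacantCylinder : Finset (Lattice d) → Set (Config d))) := by
  classical
  rintro _ ⟨K, rfl⟩ _ ⟨L, rfl⟩ -
  exact ⟨K ∪ L, (vacantCylinder_inter K L).symm⟩

theorem generateFrom_vacantCylinder (d : ℕ) :
    (inferInstance : MeasurableSpace (Config d)) =
      MeasurableSpace.generateFrom (range (vacantCylinder : Finset (Lattice d) → _)) := by
  refine le_antisymm ?_ (MeasurableSpace.generateFrom_le ?_)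
  · change MeasurableSpace.pi ≤ _
    refine iSup_le fun z => ?_
    have : Measurable[MeasurableSpace.generateFrom
        (range (vacantCylinder : Finset (Lattice d) → _))] fun y : Config d => y z := by
      refine measurable_to_bool (MeasurableSpace.measurableSet_generateFrom ⟨{z}, ?_⟩)
      ext y; simp [vacantCylinder]
    exact this.comap_le
  · rintro _ ⟨K, rfl⟩
    exact measurableSet_vacantCylinder K

theorem measurable_config_vadd {d : ℕ} (x : Lattice d) : Measurable fun y : Config d => x +ᵥ y :=
  measurable_pi_lambda (X := fun _ : Lattice d => Bool) _ fun z => measurable_config_apply (z + x)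

theorem preimage_vadd_vacantCylinder {d : ℕ} (x : Lattice d) (K : Finset (Lattice d)) :
    (fun y : Config d => x +ᵥ y) ⁻¹' vacantCylinder K =
      vacantCylinder (K.map (addRightEmbedding x)) := by
  ext y
  simp only [vacantCylinder, mem_preimage, mem_ofPred_eq, Finset.forall_mem_map]
  rfl

/-- A probability measure on configurations is invariant under shifts as soon as the probabilities
of cylinders are. -/
theorem measurePreserving_vadd_of_vacantCylinder {d : ℕ} {Q : Measure (Config d)}
    [IsProbabilityMeasure Q] (x : Lattice d)
    (h : ∀ K, Q (vacantCylinder (K.map (addRightEmbedding x))) = Q (vacantCylinder K)) :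
    MeasurePreserving (fun y : Config d => x +ᵥ y) Q Q := by
  refine ⟨measurable_config_vadd x, ?_⟩
  have := Measure.isProbabilityMeasure_map (μ := Q) (measurable_config_vadd x).aemeasurable
  refine ext_of_generate_finite _ (generateFrom_vacantCylinder d) (isPiSystem_vacantCylinder d)
    ?_ (by simp)
  rintro _ ⟨K, rfl⟩
  rw [Measure.map_apply (measurable_config_vadd x) (measurableSet_vacantCylinder K),
    preimage_vadd_vacantCylinder, h]

/-- Asymptotic independence is stable under complements and countable disjoint unions, so that it
propagates from a generating `π`-system to all measurable sets `A`, for a given family of sets `f i`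
of constant probability `c`. -/
theorem tendsto_measure_inter_of_generateFrom {α ι : Type*} {m : MeasurableSpace α}
    {Q : Measure α} [IsProbabilityMeasure Q] {l : Filter ι} {T : ι → α → α}
    (hT : ∀ i, MeasurePreserving (T i) Q Q) {S : Set (Set α)}
    (hm : m = MeasurableSpace.generateFrom S) (hS : IsPiSystem S) {f : ι → Set α}
    (hf : ∀ i, MeasurableSet (f i)) {c : ℝ} (hc : ∀ i, Q.real (f i) = c)
    (h : ∀ A ∈ S, Tendsto (fun i => Q.real (T i ⁻¹' A ∩ f i)) l (nhds (Q.real A * c)))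
    {A : Set α} (hA : MeasurableSet A) :
    Tendsto (fun i => Q.real (T i ⁻¹' A ∩ f i)) l (nhds (Q.real A * c)) := by
  induction A, hA using MeasurableSpace.induction_on_inter hm hS with
  | empty => simpa using tendsto_const_nhds
  | basic A hA => exact h A hA
  | compl A hA ih =>
    have e : ∀ i, Q.real (T i ⁻¹' Aᶜ ∩ f i) = c - Q.real (T i ⁻¹' A ∩ f i) := fun i => by
      rw [← hc i, ← measureReal_inter_add_sdiff (s := f i) ((hT i).measurable hA),
        inter_comm (f i) (T i ⁻¹' A), add_sub_cancel_left]
      congr 1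
      ext; simp [and_comm]
    simp_rw [e, probReal_compl_eq_one_sub hA, sub_mul, one_mul]
    exact tendsto_const_nhds.sub ih
  | iUnion A hd hA ih =>
    have e : ∀ i, Q.real (T i ⁻¹' (⋃ k, A k) ∩ f i) = ∑' k, Q.real (T i ⁻¹' A k ∩ f i) := by
      intro i
      rw [preimage_iUnion, iUnion_inter, measureReal_def, measure_iUnion,
        ENNReal.tsum_toReal_eq fun k => measure_ne_top _ _]
      · rfl
      · exact fun j k hjk =>
          ((hd hjk).preimage (T i)).mono inter_subset_left inter_subset_left
      · exact fun k => ((hT i).measurable (hA k)).inter (hf i)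
    have hsum : Summable fun k => Q.real (A k) :=
      ENNReal.summable_toReal (by rw [← measure_iUnion hd hA]; exact measure_ne_top _ _)
    have e' : Q.real (⋃ k, A k) = ∑' k, Q.real (A k) := by
      rw [measureReal_def, measure_iUnion hd hA, ENNReal.tsum_toReal_eq fun k => measure_ne_top _ _]
      rfl
    simp_rw [e, e', ← tsum_mul_right]
    refine tendsto_tsum_of_dominated_convergence hsum ih (Eventually.of_forall fun i k => ?_)
    rw [Real.norm_of_nonneg measureReal_nonneg]
    refine (measureReal_mono inter_subset_left).trans_eq ?_
    rw [measureReal_def, measureReal_def, (hT i).measure_preimage (hA k).nullMeasurableSet]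

/-- If cylinders become independent under shifts tending to infinity, then so do all measurable
sets, and therefore the shifts are ergodic. -/
theorem ergodicVAdd_of_vacantCylinder {d : ℕ} [NeZero d] {Q : Measure (Config d)}
    [IsProbabilityMeasure Q]
    (hinv : ∀ x : Lattice d, MeasurePreserving (fun y : Config d => x +ᵥ y) Q Q)
    (h : ∀ K L : Finset (Lattice d), Tendsto (fun x : Lattice d =>
      Q.real (vacantCylinder (L.map (addRightEmbedding x)) ∩ vacantCylinder K)) cofinite
      (nhds (Q.real (vacantCylinder L) * Q.real (vacantCylinder K)))) :
    ErgodicVAdd (Lattice d) (Config d) Q := by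
  have h1 : ∀ (K : Finset (Lattice d)) {B : Set (Config d)}, MeasurableSet B →
      Tendsto (fun x : Lattice d => Q.real ((fun y : Config d => x +ᵥ y) ⁻¹' B ∩ vacantCylinder K))
        cofinite (nhds (Q.real B * Q.real (vacantCylinder K))) := by
    intro K B hB
    refine tendsto_measure_inter_of_generateFrom hinv (generateFrom_vacantCylinder d)
      (isPiSystem_vacantCylinder d) (fun _ => measurableSet_vacantCylinder K) (fun _ => rfl) ?_ hB
    rintro _ ⟨L, rfl⟩
    simp_rw [preimage_vadd_vacantCylinder]
    exact h K L
  have h2 : ∀ {A B : Set (Config d)}, MeasurableSet A → MeasurableSet B →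
      Tendsto (fun x : Lattice d => Q.real (A ∩ (fun y : Config d => x +ᵥ y) ⁻¹' B))
        cofinite (nhds (Q.real A * Q.real B)) := by
    intro A B hA hB
    refine tendsto_measure_inter_of_generateFrom (T := fun _ => id) (fun _ => .id Q)
      (generateFrom_vacantCylinder d) (isPiSystem_vacantCylinder d)
      (fun x => (hinv x).measurable hB)
      (fun x => by
        rw [measureReal_def, measureReal_def, (hinv x).measure_preimage hB.nullMeasurableSet])
      ?_ hA
    rintro _ ⟨K, rfl⟩
    simp_rw [preimage_id, inter_comm (vacantCylinder K), mul_comm (Q.real (vacantCylinder K))]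
    exact h1 K hB
  have : VAddInvariantMeasure (Lattice d) (Config d) Q :=
    ⟨fun x _ hs => (hinv x).measure_preimage hs.nullMeasurableSet⟩
  refine ⟨fun {s} hs hs' => ?_⟩
  -- For an invariant event, mixing of the event with itself gives `Q s = Q s * Q s`.
  have hlim := h2 hs hs
  have hconst : ∀ x : Lattice d, Q.real (s ∩ (fun y : Config d => x +ᵥ y) ⁻¹' s) = Q.real s :=
    fun x => by
      rw [measureReal_congr ((ae_eq_refl s).inter (hs' x)), inter_self]
  simp_rw [hconst] at hlim
  have hsq : Q.real s = Q.real s * Q.real s := tendsto_nhds_unique tendsto_const_nhds hlim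
  rw [eventuallyConst_set']
  have h01 : Q.real s = 0 ∨ Q.real s = 1 := by
    rcases eq_or_ne (Q.real s) 0 with h0 | h0
    · exact .inl h0
    · exact .inr (mul_left_cancel₀ h0 (by rw [← hsq, mul_one]))
  rcases h01 with h0 | h1
  · left
    exact ae_eq_empty.2 ((measureReal_eq_zero_iff).1 h0)
  · right
    rw [ae_eq_univ_iff_measure_eq hs.nullMeasurableSet, measure_univ]
    simpa [measureReal_def, ENNReal.toReal_eq_one_iff] using h1

/-! ### The percolation event -/

/-- The graph induced on the sites of value `true` has an infinite connected component. -/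
def percConfig (d : ℕ) : Set (Config d) :=
  {y | ∃ C : ((latticeGraph d).induce {z | y z = true}).ConnectedComponent, C.supp.Infinite}

/-- The sites `z` which can be reached from `x` by a nearest-neighbor path of sites of value
`true`, the starting point `x` being unrestricted. -/
def openReach {d : ℕ} (y : Config d) : Lattice d → Lattice d → Prop :=
  Relation.ReflTransGen fun a b => IsNeighbor a b ∧ y b = true

theorem measurableSet_openReach {d : ℕ} (x z : Lattice d) :
    MeasurableSet {y : Config d | openReach y x z} := by
  let R : ℕ → Lattice d → Set (Config d) := fun n => Nat.rec (fun z => {_y | x = z})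
    (fun _ R z => ⋃ w, R w ∩ {y | IsNeighbor w z ∧ y z = true}) n
  have hR : ∀ n z, MeasurableSet (R n z) := by
    intro n
    induction n with
    | zero => exact fun z => MeasurableSet.const _
    | succ n ih =>
      exact fun z => MeasurableSet.iUnion fun w => (ih w).inter
        ((MeasurableSet.const _).inter (measurableSet_site z))
  have : {y : Config d | openReach y x z} = ⋃ n, R n z := by
    ext y
    simp only [mem_ofPred_eq, mem_iUnion]
    constructor
    · intro h
      induction h with
      | refl => exact ⟨0, rfl⟩
      | tail _ hbc ih =>
        obtain ⟨n, hn⟩ := ih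
        exact ⟨n + 1, mem_iUnion.2 ⟨_, hn, hbc⟩⟩
    · rintro ⟨n, hn⟩
      induction n generalizing z with
      | zero => obtain rfl : x = z := hn; exact .refl
      | succ n ih =>
        obtain ⟨w, hw, hz⟩ := mem_iUnion.1 hn
        exact (ih w hw).tail hz
  rw [this]
  exact MeasurableSet.iUnion fun n => hR n z

theorem reachable_iff_openReach {d : ℕ} (y : Config d) (a b : {z | y z = true}) :
    ((latticeGraph d).induce {z | y z = true}).Reachable a b ↔ openReach y a b := by
  rw [SimpleGraph.reachable_iff_reflTransGen]
  constructor
  · intro h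
    induction h with
    | refl => exact .refl
    | @tail _ c _ hbc ih => exact ih.tail ⟨hbc, c.2⟩
  · intro h
    obtain ⟨b, hb⟩ := b
    change openReach y a b at h
    induction h with
    | refl => exact .refl
    | @tail b' c hab hbc ih =>
      have hb' : y b' = true := by
        rcases Relation.ReflTransGen.cases_tail hab with h | ⟨_, _, h⟩
        · rw [h]; exact a.2
        · exact h.2
      exact (ih hb').tail hbc.1

theorem mem_percConfig_iff {d : ℕ} (y : Config d) :
    y ∈ percConfig d ↔ ∃ x : Lattice d, y x = true ∧ {z | openReach y x z}.Infinite := by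
  have key : ∀ a : {z | y z = true},
      Subtype.val '' (((latticeGraph d).induce {z | y z = true}).connectedComponentMk a).supp =
        {z | openReach y a z} := by
    intro a
    ext z
    simp only [mem_image, SimpleGraph.ConnectedComponent.mem_supp_iff,
      SimpleGraph.ConnectedComponent.eq, mem_ofPred_eq]
    constructor
    · rintro ⟨b, hb, rfl⟩
      exact (reachable_iff_openReach y a b).1 hb.symm
    · intro h
      have hz : y z = true := by
        rcases Relation.ReflTransGen.cases_tail h with h | ⟨_, _, h⟩
        · rw [h]; exact a.2
        · exact h.2
      exact ⟨⟨z, hz⟩, ((reachable_iff_openReach y a ⟨z, hz⟩).2 h).symm, rfl⟩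
  constructor
  · rintro ⟨C, hC⟩
    induction C using SimpleGraph.ConnectedComponent.ind with
    | h a =>
      refine ⟨a, a.2, ?_⟩
      rw [← key a]
      exact hC.image Subtype.val_injective.injOn
  · rintro ⟨x, hx, h⟩
    refine ⟨SimpleGraph.connectedComponentMk _ ⟨x, hx⟩, ?_⟩
    rw [← key ⟨x, hx⟩] at h
    exact h.of_image _

theorem measurableSet_percConfig (d : ℕ) : MeasurableSet (percConfig d) := by
  have : percConfig d = ⋃ x : Lattice d, {y | y x = true} ∩
      ⋂ F : Finset (Lattice d), ⋃ z : Lattice d, {_y | z ∉ F} ∩ {y | openReach y x z} := by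
    ext y
    simp only [mem_percConfig_iff, mem_iUnion, mem_inter_iff, mem_iInter, mem_ofPred_eq]
    refine exists_congr fun x => and_congr_right fun _ => ⟨fun h F => ?_, fun h hfin => ?_⟩
    · obtain ⟨z, hz, hF⟩ := h.exists_notMem_finset F
      exact ⟨z, hF, hz⟩
    · obtain ⟨z, hF, hz⟩ := h hfin.toFinset
      exact hF (by simpa using hz)
  rw [this]
  exact MeasurableSet.iUnion fun x => (measurableSet_site x).inter <|
    MeasurableSet.iInter fun F => MeasurableSet.iUnion fun z =>
      (MeasurableSet.const _).inter (measurableSet_openReach x z)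

theorem openReach.vadd {d : ℕ} {y : Config d} (v : Lattice d) {a b : Lattice d}
    (h : openReach y (a + v) (b + v)) : openReach (v +ᵥ y) a b := by
  have := Relation.ReflTransGen.lift
    (p := fun a b : Lattice d => IsNeighbor a b ∧ (v +ᵥ y) b = true)
    (fun z => z - v) ?_ _ _ h
  · simpa [openReach, Function.onFun] using this
  · refine fun a b hab => ⟨?_, ?_⟩
    · simpa [IsNeighbor] using hab.1
    · change y (b - v + v) = true
      simpa using hab.2

theorem preimage_vadd_percConfig {d : ℕ} (v : Lattice d) :
    (fun y : Config d => v +ᵥ y) ⁻¹' percConfig d = percConfig d := by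
  have key : ∀ (v : Lattice d) (y : Config d), y ∈ percConfig d → v +ᵥ y ∈ percConfig d := by
    intro v y hy
    rw [mem_percConfig_iff] at hy ⊢
    obtain ⟨x, hx, hinf⟩ := hy
    refine ⟨x - v, ?_, ?_⟩
    · change y (x - v + v) = true
      simpa using hx
    · refine (hinf.image (sub_left_injective (b := v)).injOn).mono ?_
      rintro _ ⟨z, hz, rfl⟩
      exact openReach.vadd v (by simpa using hz)
  ext y
  refine ⟨fun h => ?_, key v y⟩
  simpa using key (-v) _ h

/-! ### The Markov property of simple random walk -/

/-- The sequence with first entry `a` followed by the sequence `b`. -/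
def consSeq {α : Type*} (a : α) (b : ℕ → α) : ℕ → α
  | 0 => a
  | n + 1 => b n

theorem measurable_consSeq {α : Type*} [MeasurableSpace α] :
    Measurable fun p : α × (ℕ → α) => consSeq p.1 p.2 := by
  refine measurable_pi_lambda _ fun n => ?_
  cases n with
  | zero => exact measurable_fst
  | succ n => exact (measurable_pi_apply n).comp measurable_snd

theorem measurable_consSeq_right {α : Type*} [MeasurableSpace α] (a : α) :
    Measurable fun b : ℕ → α => consSeq a b :=
  measurable_consSeq.comp measurable_prodMk_left

/-- A sequence of independent variables of law `μ` is obtained by putting a variable of law `μ` in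
front of another such sequence. -/
theorem map_consSeq_infinitePi {α : Type*} [MeasurableSpace α] (μ : Measure α)
    [IsProbabilityMeasure μ] :
    (μ.prod (Measure.infinitePi fun _ : ℕ => μ)).map (fun p => consSeq p.1 p.2) =
      Measure.infinitePi fun _ : ℕ => μ := by
  classical
  refine Measure.eq_infinitePi _ fun s t ht => ?_
  have hs : MeasurableSet (Set.pi (s : Set ℕ) t) :=
    MeasurableSet.pi s.countable_toSet fun i _ => ht i
  rw [Measure.map_apply measurable_consSeq hs]
  have hpre : (fun p : α × (ℕ → α) => consSeq p.1 p.2) ⁻¹' Set.pi (s : Set ℕ) t =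
      (if 0 ∈ s then t 0 else univ) ×ˢ
        Set.pi (s.preimage Nat.succ Nat.succ_injective.injOn : Set ℕ) (fun n => t (n + 1)) := by
    ext ⟨a, b⟩
    simp only [mem_preimage, Set.mem_pi, mem_prod, Finset.coe_preimage, SetLike.mem_coe]
    constructor
    · intro h
      refine ⟨?_, fun n hn => h (n + 1) hn⟩
      split_ifs with h0
      · exact h 0 h0
      · trivial
    · rintro ⟨h0, h1⟩ (_ | n) hn
      · simpa [hn, consSeq] using h0
      · exact h1 n hn
  rw [hpre, Measure.prod_prod, Measure.infinitePi_pi _ fun n _ => ht (n + 1)]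
  have himg : ∏ n ∈ s.preimage Nat.succ Nat.succ_injective.injOn, μ (t (n + 1)) =
      ∏ n ∈ s.erase 0, μ (t n) := by
    refine Finset.prod_bij (fun n _ => n + 1) (by simp) (by simp) ?_ (by simp)
    intro n hn
    obtain ⟨hn0, hn⟩ := Finset.mem_erase.1 hn
    exact ⟨n - 1, by simpa [Nat.sub_add_cancel (Nat.pos_of_ne_zero hn0)] using hn,
      Nat.sub_add_cancel (Nat.pos_of_ne_zero hn0)⟩
  rw [himg]
  split_ifs with h0
  · rw [Finset.mul_prod_erase s (fun n => μ (t n)) h0]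
  · rw [measure_univ, one_mul, Finset.erase_eq_of_notMem h0]

instance {d : ℕ} [NeZero d] (x : Lattice d) : IsProbabilityMeasure (walkLaw x) :=
  Measure.isProbabilityMeasure_map (measurable_pathOfSteps x).aemeasurable

theorem lintegral_stepLaw {d : ℕ} [NeZero d] (F : Lattice d → ℝ≥0∞) :
    ∫⁻ e, F e ∂stepLaw d = ∑ s : Fin d × Bool, (2 * d : ℝ≥0∞)⁻¹ * F (unitVec s) := by
  rw [stepLaw, ← PMF.toMeasure_map _ _ (measurable_of_countable _),
    lintegral_map (measurable_of_countable _) (measurable_of_countable _), lintegral_fintype]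
  refine Finset.sum_congr rfl fun s _ => ?_
  rw [PMF.toMeasure_apply_singleton _ _ (measurableSet_singleton _), mul_comm]
  simp [mul_comm]

theorem pathOfSteps_consSeq {d : ℕ} (x e : Lattice d) (ξ : ℕ → Lattice d) :
    pathOfSteps x (consSeq e ξ) = consSeq x (pathOfSteps (x + e) ξ) := by
  funext n
  cases n with
  | zero => simp [pathOfSteps, consSeq]
  | succ n => simp [pathOfSteps, consSeq, Finset.sum_range_succ', add_comm, add_left_comm]

/-- The Markov property at time one. -/
theorem lintegral_walkLaw {d : ℕ} [NeZero d] (x : Lattice d) {F : (ℕ → Lattice d) → ℝ≥0∞}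
    (hF : Measurable F) :
    ∫⁻ w, F w ∂walkLaw x =
      ∑ s : Fin d × Bool, (2 * d : ℝ≥0∞)⁻¹ * ∫⁻ w, F (consSeq x w) ∂walkLaw (x + unitVec s) := by
  have hm : ∀ y : Lattice d, Measurable fun w : ℕ → Lattice d => F (consSeq y w) :=
    fun y => hF.comp (measurable_consSeq_right y)
  rw [walkLaw, lintegral_map hF (measurable_pathOfSteps x), ← map_consSeq_infinitePi,
    lintegral_map (f := fun ξ => F (pathOfSteps x ξ)) (hF.comp (measurable_pathOfSteps x))
      measurable_consSeq,
    lintegral_prod (fun p => F (pathOfSteps x (consSeq p.1 p.2)))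
      ((hF.comp (measurable_pathOfSteps x)).comp measurable_consSeq).aemeasurable,
    lintegral_stepLaw]
  refine Finset.sum_congr rfl fun s _ => ?_
  rw [walkLaw, lintegral_map (hm x) (measurable_pathOfSteps _)]
  simp_rw [pathOfSteps_consSeq]

theorem ae_walkLaw_zero {d : ℕ} [NeZero d] (x : Lattice d) : ∀ᵐ w ∂walkLaw x, w 0 = x := by
  rw [walkLaw, ae_map_iff (measurable_pathOfSteps x).aemeasurable
    (measurableSet_eq_fun (measurable_pi_apply 0) measurable_const)]
  exact Eventually.of_forall fun ξ => by simp [pathOfSteps]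

theorem walkLaw_add {d : ℕ} [NeZero d] (x z : Lattice d) :
    walkLaw (x + z) = (walkLaw x).map fun w n => w n + z := by
  rw [walkLaw, walkLaw, Measure.map_map (by fun_prop) (measurable_pathOfSteps x)]
  congr 1
  funext ξ n
  simp [pathOfSteps, add_right_comm]

/-! ### Hitting probabilities of far away sites -/

/-- A superharmonic function which is at least one at `y` dominates the probability of hitting
`y`. -/
theorem walkLaw_hit_le {d : ℕ} [NeZero d] (y : Lattice d) (ψ : Lattice d → ℝ≥0∞) (hy : 1 ≤ ψ y)
    (hψ : ∀ x, ∑ s : Fin d × Bool, (2 * d : ℝ≥0∞)⁻¹ * ψ (x + unitVec s) ≤ ψ x) (x : Lattice d) :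
    walkLaw x {w | ∃ n, w n = y} ≤ ψ x := by
  have hmeas : ∀ N : ℕ, MeasurableSet {w : ℕ → Lattice d | ∃ n < N, w n = y} := fun N => by
    have : {w : ℕ → Lattice d | ∃ n < N, w n = y} =
        ⋃ n, ⋃ (_ : n < N), (fun w => w n) ⁻¹' {y} := by
      ext; simp
    rw [this]
    exact MeasurableSet.iUnion fun n => MeasurableSet.iUnion fun _ =>
      measurable_pi_apply n (measurableSet_singleton y)
  have key : ∀ (N : ℕ) (x : Lattice d), walkLaw x {w | ∃ n < N, w n = y} ≤ ψ x := by
    intro N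
    induction N with
    | zero => simp
    | succ N ih =>
      intro x
      rcases eq_or_ne x y with rfl | hxy
      · exact prob_le_one.trans hy
      · rw [← lintegral_indicator_one (hmeas _),
          lintegral_walkLaw x (measurable_one.indicator (hmeas _))]
        refine (Finset.sum_le_sum fun s _ => ?_).trans (hψ x)
        gcongr
        refine le_trans ?_ (ih (x + unitVec s))
        rw [← lintegral_indicator_one (hmeas _)]
        refine lintegral_mono fun w => ?_
        by_cases h : consSeq x w ∈ {w : ℕ → Lattice d | ∃ n < N + 1, w n = y}
        · obtain ⟨n | n, hn, hw⟩ := h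
          · exact absurd hw hxy
          · have : w ∈ {w : ℕ → Lattice d | ∃ n < N, w n = y} := ⟨n, by omega, hw⟩
            rw [indicator_of_mem this]
            exact indicator_le_self _ _ _
        · rw [indicator_of_notMem h]
          exact zero_le
  have hU : {w : ℕ → Lattice d | ∃ n, w n = y} = ⋃ N : ℕ, {w | ∃ n < N, w n = y} := by
    ext w
    simp only [mem_ofPred_eq, mem_iUnion]
    exact ⟨fun ⟨n, hn⟩ => ⟨n + 1, n, n.lt_succ_self, hn⟩, fun ⟨_, n, _, hn⟩ => ⟨n, hn⟩⟩
  have hmono : Monotone fun N : ℕ => {w : ℕ → Lattice d | ∃ n < N, w n = y} :=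
    fun N N' h w ⟨n, hn, hw⟩ => ⟨n, hn.trans_le h, hw⟩
  rw [hU, hmono.measure_iUnion]
  exact iSup_le fun N => key N x

/-- A second order upper bound for `(1 + v) ^ (-1/4)`. The coefficient `3/16` exceeds the Taylor
coefficient `5/32`; in dimension three it is the largest constant for which the estimate in
`sum_lyapunov_le` closes. -/
theorem one_add_rpow_le {v : ℝ} (hv : |v| ≤ 1 / 8) :
    (1 + v) ^ (-(1 / 4) : ℝ) ≤ 1 - v / 4 + 3 / 16 * v ^ 2 := by
  obtain ⟨h1, h2⟩ := abs_le.1 hv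
  have hq : 0 < 1 - v / 4 + 3 / 16 * v ^ 2 := by nlinarith
  have hpoly : 1 ≤ (1 + v) * (1 - v / 4 + 3 / 16 * v ^ 2) ^ 4 := by
    have hk : ∀ k, 2 ≤ k → |v ^ k| ≤ 1 / 64 := fun k hk => by
      rw [abs_pow]
      calc |v| ^ k ≤ |v| ^ 2 := pow_le_pow_of_le_one (abs_nonneg v) (by linarith) hk
        _ ≤ (1 / 8) ^ 2 := pow_le_pow_left₀ (abs_nonneg v) hv 2
        _ = 1 / 64 := by norm_num
    have e : (1 + v) * (1 - v / 4 + 3 / 16 * v ^ 2) ^ 4 = 1 + v ^ 2 * (1 / 8 + v / 2 -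
        69 / 256 * v ^ 2 + 61 / 256 * v ^ 3 - 159 / 2048 * v ^ 4 + 135 / 4096 * v ^ 5 -
        351 / 65536 * v ^ 6 + 81 / 65536 * v ^ 7) := by ring
    rw [e]
    refine le_add_of_nonneg_right (mul_nonneg (sq_nonneg v) ?_)
    have h2 := abs_le.1 (hk 2 le_rfl)
    have h3 := abs_le.1 (hk 3 (by norm_num))
    have h4 := abs_le.1 (hk 4 (by norm_num))
    have h5 := abs_le.1 (hk 5 (by norm_num))
    have h6 := abs_le.1 (hk 6 (by norm_num))
    have h7 := abs_le.1 (hk 7 (by norm_num))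
    linarith [h2.2, h3.1, h4.2, h5.1, h6.2, h7.1]
  have h4 : (1 + v)⁻¹ ≤ (1 - v / 4 + 3 / 16 * v ^ 2) ^ 4 := by
    rw [inv_le_iff_one_le_mul₀' (by linarith)]
    exact hpoly
  calc (1 + v) ^ (-(1 / 4) : ℝ) = ((1 + v)⁻¹) ^ (1 / 4 : ℝ) := by
        rw [Real.rpow_neg (by linarith), Real.inv_rpow (by linarith)]
    _ ≤ ((1 - v / 4 + 3 / 16 * v ^ 2) ^ 4) ^ (1 / 4 : ℝ) :=
        Real.rpow_le_rpow (inv_nonneg.2 (by linarith)) h4 (by norm_num)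
    _ = _ := by
        rw [← Real.rpow_natCast, ← Real.rpow_mul hq.le]
        norm_num

theorem one_add_div_four_le_rpow {h : ℝ} (h1 : h < 1) :
    1 + h / 4 ≤ (1 - h) ^ (-(1 / 4) : ℝ) := by
  have h0 : 0 < 1 - h := by linarith
  calc 1 + h / 4 ≤ Real.exp (h / 4) := by linarith [Real.add_one_le_exp (h / 4)]
    _ = (Real.exp (-h)) ^ (-(1 / 4) : ℝ) := by
        rw [← Real.exp_mul]; congr 1; ring
    _ ≤ _ := Real.rpow_le_rpow_of_nonpos h0 (by linarith [Real.add_one_le_exp (-h)]) (by norm_num)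

/-- The square of the Euclidean norm of a site. -/
noncomputable def normSq {d : ℕ} (x : Lattice d) : ℝ := ∑ i, (x i : ℝ) ^ 2

/-- The function `(|x|² + 256) ^ (-1/4)`, which is superharmonic in dimension at least three. The
constant makes the relative increments small enough for a second order expansion. -/
noncomputable def lyapunov {d : ℕ} (x : Lattice d) : ℝ := (256 + normSq x) ^ (-(1 / 4) : ℝ)

theorem normSq_nonneg {d : ℕ} (x : Lattice d) : 0 ≤ normSq x :=
  Finset.sum_nonneg fun _ _ => sq_nonneg _

theorem lyapunov_pos {d : ℕ} (x : Lattice d) : 0 < lyapunov x :=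
  Real.rpow_pos_of_pos (by linarith [normSq_nonneg x]) _

theorem normSq_add_unitVec {d : ℕ} (x : Lattice d) (s : Fin d × Bool) :
    normSq (x + unitVec s) = normSq x + 1 + (if s.2 then 2 * x s.1 else -(2 * x s.1) : ℝ) := by
  have h : normSq (x + unitVec s) - normSq x =
      ∑ i, (((x + unitVec s) i : ℝ) ^ 2 - (x i : ℝ) ^ 2) := by
    rw [Finset.sum_sub_distrib]; rfl
  rw [Finset.sum_eq_single s.1] at h
  · obtain ⟨i, b⟩ := s
    cases b <;> simp [unitVec] at h ⊢ <;> linarith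
  · intro i _ hi
    obtain ⟨j, b⟩ := s
    cases b <;> simp [unitVec, Pi.single_eq_of_ne hi]
  · simp

theorem sum_lyapunov_le {d : ℕ} (hd : 3 ≤ d) (x : Lattice d) :
    ∑ s : Fin d × Bool, lyapunov (x + unitVec s) ≤ 2 * d * lyapunov x := by
  have hn := normSq_nonneg x
  obtain ⟨a, ha⟩ : ∃ a : ℝ, a = 257 + normSq x := ⟨_, rfl⟩
  have ha0 : 0 < a := by linarith
  -- The two steps along the `i`-th axis change `|x|² + 256` to `a (1 ± v)`, with `v = 2 xᵢ / a`.
  have hpair : ∀ i, lyapunov (x + unitVec (i, true)) + lyapunov (x + unitVec (i, false)) ≤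
      a ^ (-(1 / 4) : ℝ) * (2 + 3 / 8 * (2 * x i / a) ^ 2) := by
    intro i
    have hi : (x i : ℝ) ^ 2 ≤ normSq x :=
      Finset.single_le_sum (f := fun i => (x i : ℝ) ^ 2) (fun _ _ => sq_nonneg _)
        (Finset.mem_univ i)
    have hv : |2 * x i / a| ≤ 1 / 8 := by
      rw [abs_div, abs_of_pos ha0, div_le_iff₀ ha0, abs_mul, abs_two]
      nlinarith [sq_abs (x i : ℝ), sq_nonneg (|(x i : ℝ)| - 16)]
    have e : ∀ v : ℝ, |v| ≤ 1 / 8 → (a * (1 + v)) ^ (-(1 / 4) : ℝ) ≤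
        a ^ (-(1 / 4) : ℝ) * (1 - v / 4 + 3 / 16 * v ^ 2) := fun v hv => by
      rw [Real.mul_rpow ha0.le (by linarith [(abs_le.1 hv).1])]
      exact mul_le_mul_of_nonneg_left (one_add_rpow_le hv) (Real.rpow_nonneg ha0.le _)
    have e1 : lyapunov (x + unitVec (i, true)) = (a * (1 + 2 * x i / a)) ^ (-(1 / 4) : ℝ) := by
      rw [lyapunov, normSq_add_unitVec]
      congr 1
      simp only [if_true]
      field_simp
      linarith
    have e2 : lyapunov (x + unitVec (i, false)) =
        (a * (1 + -(2 * x i / a))) ^ (-(1 / 4) : ℝ) := by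
      rw [lyapunov, normSq_add_unitVec]
      congr 1
      simp only [Bool.false_eq_true, if_false]
      field_simp
      linarith
    rw [e1, e2]
    have := add_le_add (e _ hv) (e _ ((abs_neg _).trans_le hv))
    linarith
  have hsum : ∑ s : Fin d × Bool, lyapunov (x + unitVec s) ≤
      a ^ (-(1 / 4) : ℝ) * (2 * d + 3 / 2 * (normSq x / a ^ 2)) := by
    rw [Fintype.sum_prod_type]
    simp only [Fintype.sum_bool]
    refine (Finset.sum_le_sum fun i _ => hpair i).trans_eq ?_
    rw [← Finset.mul_sum, Finset.sum_add_distrib, normSq, Finset.sum_div, Finset.mul_sum]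
    congr 2
    · simp [mul_comm]
    · exact Finset.sum_congr rfl fun i _ => by ring
  have hle : normSq x / a ^ 2 ≤ 1 / a := by
    rw [div_le_div_iff₀ (by positivity) ha0]
    nlinarith
  have hd' : (3 : ℝ) ≤ d := by exact_mod_cast hd
  have hbound : 2 * d + 3 / 2 * (normSq x / a ^ 2) ≤ 2 * d * (1 + (1 / a) / 4) := by
    have : 0 < 1 / a := by positivity
    nlinarith
  have hlast : a ^ (-(1 / 4) : ℝ) * (1 + (1 / a) / 4) ≤ lyapunov x := by
    have h1 : 1 / a < 1 := by rw [div_lt_one ha0]; linarith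
    have e : lyapunov x = a ^ (-(1 / 4) : ℝ) * (1 - 1 / a) ^ (-(1 / 4) : ℝ) := by
      rw [← Real.mul_rpow ha0.le (by linarith), lyapunov]
      congr 1
      field_simp
      linarith
    rw [e]
    exact mul_le_mul_of_nonneg_left (one_add_div_four_le_rpow h1) (Real.rpow_nonneg ha0.le _)
  calc _ ≤ a ^ (-(1 / 4) : ℝ) * (2 * d + 3 / 2 * (normSq x / a ^ 2)) := hsum
    _ ≤ a ^ (-(1 / 4) : ℝ) * (2 * d * (1 + (1 / a) / 4)) :=
        mul_le_mul_of_nonneg_left hbound (Real.rpow_nonneg ha0.le _)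
    _ = 2 * d * (a ^ (-(1 / 4) : ℝ) * (1 + (1 / a) / 4)) := by ring
    _ ≤ _ := mul_le_mul_of_nonneg_left hlast (by positivity)

theorem tendsto_normSq {d : ℕ} : Tendsto (normSq : Lattice d → ℝ) cofinite atTop := by
  have h : Tendsto (fun x : Lattice d => ‖x‖) cofinite atTop := by
    rw [← cocompact_eq_cofinite]
    exact tendsto_norm_cocompact_atTop
  have h2 : Tendsto (fun x : Lattice d => ‖x‖ ^ 2) cofinite atTop :=
    (tendsto_pow_atTop two_ne_zero).comp h
  refine tendsto_atTop_mono (fun x => ?_) h2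
  rw [← Real.le_sqrt (norm_nonneg _) (normSq_nonneg x),
    pi_norm_le_iff_of_nonneg (Real.sqrt_nonneg _)]
  intro i
  rw [Int.norm_eq_abs]
  refine Real.abs_le_sqrt ?_
  exact Finset.single_le_sum (f := fun i => (x i : ℝ) ^ 2) (fun _ _ => sq_nonneg _)
    (Finset.mem_univ i)

theorem tendsto_lyapunov {d : ℕ} : Tendsto (lyapunov : Lattice d → ℝ) cofinite (nhds 0) :=
  (tendsto_rpow_neg_atTop (by norm_num)).comp (tendsto_atTop_add_const_left _ _ tendsto_normSq)

/-- The probability that simple random walk started at `x` hits `y` is at most the value at `x - y`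
of a superharmonic function tending to zero at infinity. -/
theorem walkLaw_hit_le_lyapunov {d : ℕ} [NeZero d] (hd : 3 ≤ d) (x y : Lattice d) :
    walkLaw x {w | ∃ n, w n = y} ≤
      ENNReal.ofReal (lyapunov (x - y) / lyapunov (0 : Lattice d)) := by
  have h0 := lyapunov_pos (0 : Lattice d)
  refine walkLaw_hit_le y (fun x => ENNReal.ofReal (lyapunov (x - y) / lyapunov (0 : Lattice d)))
    ?_ (fun x => ?_) x
  · simp [h0.ne']
  · have hd0 : (0 : ℝ) < 2 * d := by
      have : 0 < d := by omega
      positivity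
    have hc : (2 * d : ℝ≥0∞)⁻¹ = ENNReal.ofReal (2 * d : ℝ)⁻¹ := by
      rw [ENNReal.ofReal_inv_of_pos hd0, ENNReal.ofReal_mul zero_le_two]
      simp
    rw [← Finset.mul_sum, ← ENNReal.ofReal_sum_of_nonneg
      fun s _ => (div_pos (lyapunov_pos _) h0).le, hc, ← ENNReal.ofReal_mul (by positivity)]
    refine ENNReal.ofReal_le_ofReal ?_
    rw [← Finset.sum_div, ← mul_div_assoc]
    refine div_le_div_of_nonneg_right ?_ h0.le
    rw [inv_mul_le_iff₀ hd0]
    simpa only [add_sub_right_comm] using sum_lyapunov_le hd (x - y)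

theorem tendsto_walkLaw_hit {d : ℕ} [NeZero d] (hd : 3 ≤ d) (x y : Lattice d) :
    Tendsto (fun z : Lattice d => walkLaw x {w | ∃ n, w n = y + z}) cofinite (nhds 0) := by
  have hinj : Tendsto (fun z : Lattice d => x - (y + z)) cofinite cofinite :=
    Function.Injective.tendsto_cofinite fun a b h => by simpa using h
  have h := ENNReal.tendsto_ofReal
    ((tendsto_lyapunov.comp hinj).div_const (lyapunov (0 : Lattice d)))
  rw [zero_div, ENNReal.ofReal_zero] at h
  exact tendsto_of_tendsto_of_tendsto_of_le_of_le tendsto_const_nhds h (fun _ => zero_le)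
    fun z => walkLaw_hit_le_lyapunov hd x (y + z)

/-! ### The stationary two-sided walk -/

/-- The two-sided sequence following `b` in positive time and `a` in negative time. -/
def glueSeq {d : ℕ} (a b : ℕ → Lattice d) : ℤ → Lattice d :=
  fun n => if 0 ≤ n then b n.toNat else a (-n).toNat

theorem measurable_glueSeq (d : ℕ) :
    Measurable fun p : (ℕ → Lattice d) × (ℕ → Lattice d) => glueSeq p.1 p.2 := by
  refine measurable_pi_lambda _ fun n => ?_
  unfold glueSeq
  split_ifs
  · exact (measurable_pi_apply _).comp measurable_snd
  · exact (measurable_pi_apply _).comp measurable_fst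

theorem glueSeq_natCast {d : ℕ} (a b : ℕ → Lattice d) (n : ℕ) : glueSeq a b n = b n := by
  simp [glueSeq]

theorem glueSeq_neg_natCast {d : ℕ} {a b : ℕ → Lattice d} (h : a 0 = b 0) (n : ℕ) :
    glueSeq a b (-n) = a n := by
  cases n with
  | zero => simp [glueSeq, h]
  | succ n =>
    have : ¬ (0 : ℤ) ≤ -((n + 1 : ℕ) : ℤ) := by omega
    rw [glueSeq, if_neg this]
    simp

/-- The law of the doubly infinite simple random walk whose position at time zero is distributed as
the counting measure on the lattice. It has infinite mass. -/
noncomputable def twoSidedLaw (d : ℕ) [NeZero d] : Measure (ℤ → Lattice d) :=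
  Measure.sum fun x : Lattice d => ((walkLaw x).prod (walkLaw x)).map fun p => glueSeq p.1 p.2

/-- The time shift by `k` of a doubly infinite sequence. -/
def timeShift {α : Type*} (k : ℤ) (w : ℤ → α) : ℤ → α := fun n => w (n + k)

theorem measurable_timeShift {α : Type*} [MeasurableSpace α] (k : ℤ) :
    Measurable (timeShift k : (ℤ → α) → ℤ → α) :=
  measurable_pi_lambda _ fun n => measurable_pi_apply (n + k)

theorem lintegral_twoSidedLaw {d : ℕ} [NeZero d] {F : (ℤ → Lattice d) → ℝ≥0∞}
    (hF : Measurable F) :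
    ∫⁻ w, F w ∂twoSidedLaw d =
      ∑' x : Lattice d, ∫⁻ a, ∫⁻ b, F (glueSeq a b) ∂walkLaw x ∂walkLaw x := by
  rw [twoSidedLaw, lintegral_sum_measure]
  refine tsum_congr fun x => ?_
  rw [lintegral_map hF (measurable_glueSeq d),
    lintegral_prod (fun p => F (glueSeq p.1 p.2)) (hF.comp (measurable_glueSeq d)).aemeasurable]

theorem twoSidedLaw_apply {d : ℕ} [NeZero d] {S : Set (ℤ → Lattice d)} (hS : MeasurableSet S) :
    twoSidedLaw d S = ∑' x : Lattice d,
      ((walkLaw x).prod (walkLaw x)) ((fun p => glueSeq p.1 p.2) ⁻¹' S) := by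
  rw [twoSidedLaw, Measure.sum_apply _ hS]
  exact tsum_congr fun x => Measure.map_apply (measurable_glueSeq d) hS

theorem timeShift_glueSeq {d : ℕ} (a b : ℕ → Lattice d) :
    timeShift 1 (glueSeq a (consSeq (a 0) b)) = glueSeq (consSeq (b 0) a) b := by
  funext n
  obtain ⟨m, rfl | rfl⟩ := n.eq_nat_or_neg
  · rw [glueSeq_natCast]
    exact glueSeq_natCast _ _ (m + 1)
  · rw [glueSeq_neg_natCast (a := consSeq (b 0) a) (b := b) rfl]
    cases m with
    | zero => exact glueSeq_natCast _ _ 1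
    | succ m =>
      change glueSeq a (consSeq (a 0) b) (-((m + 1 : ℕ) : ℤ) + 1) = a m
      have : -((m + 1 : ℕ) : ℤ) + 1 = -(m : ℤ) := by push_cast; ring
      rw [this, glueSeq_neg_natCast (a := a) (b := consSeq (a 0) b) rfl]

theorem unitVec_not {d : ℕ} (s : Fin d × Bool) :
    unitVec (s.1, !s.2) = -unitVec s := by
  obtain ⟨i, b⟩ := s
  cases b <;> simp [unitVec]

/-- The two-sided walk started from counting measure is stationary. This expresses both the Markov
property and the reversibility of simple random walk. -/
theorem measurePreserving_timeShift_one (d : ℕ) [NeZero d] :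
    MeasurePreserving (timeShift 1) (twoSidedLaw d) (twoSidedLaw d) := by
  refine ⟨measurable_timeShift 1, Measure.ext_of_lintegral _ fun F hF => ?_⟩
  have hF2 : Measurable fun p : (ℕ → Lattice d) × (ℕ → Lattice d) => F (glueSeq p.1 p.2) :=
    hF.comp (measurable_glueSeq d)
  rw [lintegral_map hF (measurable_timeShift 1), lintegral_twoSidedLaw hF,
    lintegral_twoSidedLaw (F := fun w => F (timeShift 1 w)) (hF.comp (measurable_timeShift 1))]
  let c : ℝ≥0∞ := (2 * d : ℝ≥0∞)⁻¹
  let G : Lattice d → Lattice d → ℝ≥0∞ := fun z y =>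
    ∫⁻ a, ∫⁻ b, F (glueSeq (consSeq z a) b) ∂walkLaw z ∂walkLaw y
  have hcons : ∀ z : Lattice d, Measurable fun p : (ℕ → Lattice d) × (ℕ → Lattice d) =>
      F (glueSeq (consSeq z p.1) p.2) := fun z =>
    hF2.comp (((measurable_consSeq_right z).comp measurable_fst).prodMk measurable_snd)
  have hleft : ∀ x : Lattice d, ∫⁻ a, ∫⁻ b, F (timeShift 1 (glueSeq a b)) ∂walkLaw x ∂walkLaw x =
      ∑ s : Fin d × Bool, c * G (x + unitVec s) x := by
    intro x
    have h1 : ∀ᵐ a ∂walkLaw x, ∫⁻ b, F (timeShift 1 (glueSeq a b)) ∂walkLaw x =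
        ∑ s : Fin d × Bool, c * ∫⁻ b, F (glueSeq (consSeq (x + unitVec s) a) b)
          ∂walkLaw (x + unitVec s) := by
      filter_upwards [ae_walkLaw_zero x] with a ha
      have hm : Measurable fun b => F (timeShift 1 (glueSeq a b)) :=
        ((hF.comp (measurable_timeShift 1)).comp (measurable_glueSeq d)).comp measurable_prodMk_left
      rw [lintegral_walkLaw x hm]
      refine Finset.sum_congr rfl fun s _ => ?_
      congr 1
      refine lintegral_congr_ae ?_
      filter_upwards [ae_walkLaw_zero (x + unitVec s)] with b hb
      have e := timeShift_glueSeq a b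
      rw [ha, hb] at e
      rw [e]
    have hmi : ∀ s : Fin d × Bool, Measurable fun a =>
        ∫⁻ b, F (glueSeq (consSeq (x + unitVec s) a) b) ∂walkLaw (x + unitVec s) := fun s =>
      (hcons (x + unitVec s)).lintegral_prod_right'
    rw [lintegral_congr_ae h1, lintegral_finsetSum _ fun s _ => (hmi s).const_mul c]
    exact Finset.sum_congr rfl fun s _ => lintegral_const_mul c (hmi s)
  have hright : ∀ z : Lattice d, ∫⁻ a, ∫⁻ b, F (glueSeq a b) ∂walkLaw z ∂walkLaw z =
      ∑ s : Fin d × Bool, c * G z (z + unitVec s) := fun z =>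
    lintegral_walkLaw z hF2.lintegral_prod_right'
  simp only [hleft, hright]
  simp_rw [← tsum_fintype (L := .unconditional _)]
  rw [ENNReal.tsum_comm, ENNReal.tsum_comm (α := Lattice d)]
  -- Both sides sum over pairs of neighbors. They match after exchanging a step with its opposite.
  let e : Fin d × Bool ≃ Fin d × Bool := (Equiv.refl (Fin d)).prodCongr Equiv.boolNot
  rw [← e.tsum_eq]
  refine tsum_congr fun s => ?_
  have he : unitVec (e s) = -unitVec s := unitVec_not s
  rw [← (Equiv.addRight (-unitVec s)).tsum_eq fun z => c * G z (z + unitVec s)]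
  simp only [he, Equiv.coe_addRight, neg_add_cancel_right]

theorem measure_preimage_timeShift {d : ℕ} [NeZero d] (k : ℤ) {S : Set (ℤ → Lattice d)}
    (hS : MeasurableSet S) : twoSidedLaw d (timeShift k ⁻¹' S) = twoSidedLaw d S := by
  have hadd : ∀ (j k : ℤ) (S : Set (ℤ → Lattice d)),
      timeShift j ⁻¹' (timeShift k ⁻¹' S) = timeShift (k + j) ⁻¹' S := fun j k S => by
    have : ∀ w : ℤ → Lattice d, timeShift k (timeShift j w) = timeShift (k + j) w := fun w => by
      funext n; simp only [timeShift, add_assoc]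
    ext w; rw [mem_preimage, mem_preimage, this, mem_preimage]
  have h1 := fun {S : Set (ℤ → Lattice d)} (hS : MeasurableSet S) =>
    (measurePreserving_timeShift_one d).measure_preimage hS.nullMeasurableSet
  induction k with
  | zero =>
    have : (timeShift 0 : (ℤ → Lattice d) → ℤ → Lattice d) = id := by
      funext w n; simp [timeShift]
    rw [this, preimage_id]
  | succ k ih => rw [← ih, ← h1 (measurable_timeShift k hS), hadd]
  | pred k ih =>
    rw [← ih, ← h1 (measurable_timeShift _ hS), hadd]
    rw [sub_add_cancel]

/-- Spatial translations preserve the two-sided walk. -/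
theorem measure_preimage_translate {d : ℕ} [NeZero d] (z : Lattice d) {S : Set (ℤ → Lattice d)}
    (hS : MeasurableSet S) :
    twoSidedLaw d ((fun w n => w n + z) ⁻¹' S) = twoSidedLaw d S := by
  have hm : Measurable fun (w : ℤ → Lattice d) n => w n + z := by fun_prop
  have hm' : Measurable fun (w : ℕ → Lattice d) n => w n + z := by fun_prop
  rw [twoSidedLaw_apply (hm hS), twoSidedLaw_apply hS]
  symm
  rw [← (Equiv.addRight z).tsum_eq]
  refine tsum_congr fun x => ?_
  rw [Equiv.coe_addRight, walkLaw_add, Measure.map_prod_map _ _ hm' hm',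
    Measure.map_apply (hm'.prodMap hm') (measurable_glueSeq d hS)]
  congr 1
  ext ⟨a, b⟩
  simp only [mem_preimage, Prod.map]
  have : (fun n => glueSeq a b n + z) = glueSeq (fun n => a n + z) (fun n => b n + z) := by
    funext n
    simp only [glueSeq]
    split_ifs <;> rfl
  rw [this]

/-- The event that `K` is visited for the first time at time `k`. -/
def firstVisit {d : ℕ} (K : Finset (Lattice d)) (k : ℤ) : Set (ℤ → Lattice d) :=
  {w | w k ∈ K ∧ ∀ n < k, w n ∉ K}

theorem measurableSet_mem {d : ℕ} (K : Finset (Lattice d)) (k : ℤ) :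
    MeasurableSet {w : ℤ → Lattice d | w k ∈ K} :=
  measurable_pi_apply k K.measurableSet

theorem measurableSet_firstVisit {d : ℕ} (K : Finset (Lattice d)) (k : ℤ) :
    MeasurableSet (firstVisit K k) := by
  have : firstVisit K k = {w | w k ∈ K} ∩ ⋂ n, ⋂ (_ : n < k), {w | w n ∈ K}ᶜ := by
    ext w; simp [firstVisit]
  rw [this]
  exact (measurableSet_mem K k).inter <| MeasurableSet.iInter fun n => MeasurableSet.iInter fun _ =>
    (measurableSet_mem K n).compl

theorem measurableSet_hits {d : ℕ} (K : Finset (Lattice d)) :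
    MeasurableSet {w : ℤ → Lattice d | ∃ n, w n ∈ K} := by
  have : {w : ℤ → Lattice d | ∃ n, w n ∈ K} = ⋃ n, {w | w n ∈ K} := by ext; simp
  rw [this]
  exact MeasurableSet.iUnion fun n => measurableSet_mem K n

theorem pairwise_disjoint_firstVisit {d : ℕ} (K : Finset (Lattice d)) :
    Pairwise (Function.onFun Disjoint (firstVisit K)) := by
  intro j k hjk
  refine disjoint_left.2 fun w hj hk => ?_
  rcases lt_or_gt_of_ne hjk with h | h
  · exact hk.2 j h hj.1
  · exact hj.2 k h hk.1

theorem preimage_timeShift_firstVisit {d : ℕ} (K : Finset (Lattice d)) (j k : ℤ) :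
    timeShift j ⁻¹' firstVisit K k = firstVisit K (k + j) := by
  ext w
  simp only [firstVisit, timeShift, mem_preimage, mem_ofPred_eq]
  refine and_congr_right fun _ => ⟨fun h n hn => ?_, fun h n hn => h _ (by omega)⟩
  simpa using h (n - j) (by omega)

/-- A transient trajectory visiting `K` has a first time of visit. -/
theorem exists_mem_firstVisit {d : ℕ} {K : Finset (Lattice d)} {w : ℤ → Lattice d}
    (hw : w ∈ wSet d) (h : ∃ n, w n ∈ K) : ∃ k, w ∈ firstVisit K k := by
  have hfin : {n | w n ∈ K}.Finite := by
    have := hw.2 K.finite_toSet.compl_mem_cofinite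
    rw [Filter.mem_map, mem_cofinite, ← preimage_compl, compl_compl] at this
    exact this
  obtain ⟨k, hk, hmin⟩ := exists_min_image _ id hfin h
  exact ⟨k, hk, fun n hn hnK => absurd (hmin n hnK) (not_le.2 hn)⟩

theorem tsum_measure_inter_firstVisit {d : ℕ} [NeZero d] {A : Set (ℤ → Lattice d)}
    (hA : MeasurableSet A) (hAW : A ⊆ wSet d) (K : Finset (Lattice d)) :
    ∑' k, twoSidedLaw d (A ∩ firstVisit K k) = twoSidedLaw d (A ∩ {w | ∃ n, w n ∈ K}) := by
  rw [← measure_iUnion (fun j k hjk => (pairwise_disjoint_firstVisit K hjk).mono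
    inter_subset_right inter_subset_right) fun k => hA.inter (measurableSet_firstVisit K k),
    ← inter_iUnion]
  congr 1
  ext w
  simp only [mem_inter_iff, mem_iUnion]
  exact and_congr_right fun hw => ⟨fun ⟨k, hk⟩ => ⟨k, hk.1⟩, exists_mem_firstVisit (hAW hw)⟩

/-- Consistency: seen from the first visit to `K`, a trajectory started at its first visit to a
larger set `L` and visiting `K` is distributed as one started at its first visit to `K`. Only
stationarity is used, by decomposing according to the time elapsed between the two visits. -/
theorem measure_inter_firstVisit_of_subset {d : ℕ} [NeZero d] {A : Set (ℤ → Lattice d)}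
    (hA : MeasurableSet A) (hAW : A ⊆ wSet d) (hinv : ∀ k, timeShift k ⁻¹' A = A)
    {K L : Finset (Lattice d)} (hKL : K ⊆ L) :
    twoSidedLaw d (A ∩ {w | ∃ n, w n ∈ K} ∩ firstVisit L 0) =
      twoSidedLaw d (A ∩ firstVisit K 0) := by
  have h1 := tsum_measure_inter_firstVisit (hA.inter (measurableSet_firstVisit L 0))
    (inter_subset_left.trans hAW) K
  have h2 := tsum_measure_inter_firstVisit (hA.inter (measurableSet_firstVisit K 0))
    (inter_subset_left.trans hAW) L
  have e1 : A ∩ firstVisit L 0 ∩ {w | ∃ n, w n ∈ K} =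
      A ∩ {w | ∃ n, w n ∈ K} ∩ firstVisit L 0 := inter_right_comm _ _ _
  have e2 : A ∩ firstVisit K 0 ∩ {w | ∃ n, w n ∈ L} = A ∩ firstVisit K 0 :=
    inter_eq_left.2 fun w hw => ⟨0, hKL hw.2.1⟩
  rw [e1] at h1
  rw [e2] at h2
  rw [← h1, ← h2, ← (Equiv.neg ℤ).tsum_eq]
  refine tsum_congr fun k => ?_
  rw [← measure_preimage_timeShift k ((hA.inter (measurableSet_firstVisit L 0)).inter
    (measurableSet_firstVisit K _)), preimage_inter, preimage_inter, hinv,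
    preimage_timeShift_firstVisit, preimage_timeShift_firstVisit]
  simp only [Equiv.neg_apply, zero_add, neg_add_cancel]
  rw [inter_right_comm]

theorem measure_inter_zero_mem_le {d : ℕ} [NeZero d] (K : Finset (Lattice d))
    {S : Set (ℤ → Lattice d)} (hS : MeasurableSet S) :
    twoSidedLaw d (S ∩ {w | w 0 ∈ K}) ≤
      ∑ x ∈ K, ((walkLaw x).prod (walkLaw x)) ((fun p => glueSeq p.1 p.2) ⁻¹' S) := by
  rw [twoSidedLaw_apply (hS.inter (measurableSet_mem K 0)), tsum_eq_sum (s := K)]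
  · exact Finset.sum_le_sum fun x _ => measure_mono (preimage_mono inter_subset_left)
  · intro x hx
    rw [← nonpos_iff_eq_zero]
    have h0 : ∀ᵐ p ∂(walkLaw x).prod (walkLaw x), p.2 0 = x :=
      Measure.quasiMeasurePreserving_snd.ae (ae_walkLaw_zero x)
    refine (measure_mono fun p hp => ?_).trans_eq (ae_iff.1 h0)
    intro h
    exact hx (by simpa [glueSeq, h] using hp.2)

theorem twoSidedLaw_zero_mem_lt_top {d : ℕ} [NeZero d] (K : Finset (Lattice d)) :
    twoSidedLaw d {w | w 0 ∈ K} < ∞ := by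
  have := measure_inter_zero_mem_le K (S := univ) .univ
  rw [univ_inter] at this
  exact this.trans_lt (ENNReal.sum_lt_top.2 fun x _ => measure_lt_top _ _)

/-- A walk starting in `K` visits `L` with a probability bounded by hitting probabilities of the
one-sided walk. -/
theorem twoSidedLaw_hits_le {d : ℕ} [NeZero d] (K L : Finset (Lattice d)) :
    twoSidedLaw d ({w | ∃ n, w n ∈ L} ∩ {w | w 0 ∈ K}) ≤
      ∑ x ∈ K, ∑ y ∈ L, 2 * walkLaw x {w | ∃ n, w n = y} := by
  refine (measure_inter_zero_mem_le K (measurableSet_hits L)).trans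
    (Finset.sum_le_sum fun x _ => ?_)
  have hsub : (fun p : (ℕ → Lattice d) × (ℕ → Lattice d) => glueSeq p.1 p.2) ⁻¹'
      {w | ∃ n, w n ∈ L} ⊆
        ⋃ y ∈ L, (({w | ∃ n, w n = y} ×ˢ univ) ∪ (univ ×ˢ {w | ∃ n, w n = y})) := by
    rintro ⟨a, b⟩ ⟨n, hn⟩
    refine mem_iUnion₂.2 ⟨_, hn, ?_⟩
    by_cases h : 0 ≤ n
    · exact .inr ⟨trivial, n.toNat, by simp [glueSeq, h]⟩
    · exact .inl ⟨⟨(-n).toNat, by simp [glueSeq, h]⟩, trivial⟩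
  refine (measure_mono hsub).trans ((measure_biUnion_finset_le _ _).trans
    (Finset.sum_le_sum fun y _ => ?_))
  refine (measure_union_le _ _).trans_eq ?_
  rw [Measure.prod_prod, Measure.prod_prod, measure_univ, one_mul, mul_one, two_mul]

/-! ### The intensity measure in terms of the two-sided walk -/

theorem IsNeighbor.symm {d : ℕ} {x y : Lattice d} (h : IsNeighbor x y) : IsNeighbor y x :=
  (latticeGraph d).symm.symm _ _ h

theorem glueSeq_mem_wSet_iff {d : ℕ} {a b : ℕ → Lattice d} (h : a 0 = b 0) :
    glueSeq a b ∈ wSet d ↔ a ∈ wPlusSet d ∧ b ∈ wPlusSet d := by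
  have hneg := glueSeq_neg_natCast h
  have hpos := glueSeq_natCast a b
  have htop : Tendsto (glueSeq a b) atTop cofinite ↔ Tendsto b atTop cofinite := by
    rw [← Nat.map_cast_int_atTop, tendsto_map'_iff]
    exact tendsto_congr hpos
  have hbot : Tendsto (glueSeq a b) atBot cofinite ↔ Tendsto a atTop cofinite := by
    rw [← map_neg_atTop, tendsto_map'_iff, ← Nat.map_cast_int_atTop, tendsto_map'_iff]
    exact tendsto_congr hneg
  simp only [wSet, wPlusSet, mem_ofPred_eq, Int.cofinite_eq, tendsto_sup, htop, hbot]
  constructor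
  · rintro ⟨hn, ha, hb⟩
    refine ⟨⟨fun n => ?_, ha⟩, fun n => ?_, hb⟩
    · have := (hn (-((n + 1 : ℕ) : ℤ))).symm
      have e : -((n + 1 : ℕ) : ℤ) + 1 = -(n : ℤ) := by push_cast; ring
      rwa [e, hneg, hneg] at this
    · have := hn n
      rw [hpos] at this
      rw [← hpos]
      exact_mod_cast this
  · rintro ⟨⟨hna, ha⟩, hnb, hb⟩
    refine ⟨fun n => ?_, ha, hb⟩
    by_cases h0 : 0 ≤ n
    · lift n to ℕ using h0
      have := hnb n
      rw [← hpos, ← hpos] at this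
      exact_mod_cast this
    · obtain ⟨m, rfl⟩ : ∃ m : ℕ, n = -((m + 1 : ℕ) : ℤ) := ⟨(-n - 1).toNat, by omega⟩
      have e : -((m + 1 : ℕ) : ℤ) + 1 = -(m : ℤ) := by push_cast; ring
      rw [e, hneg, hneg]
      exact (hna m).symm

theorem glueSeq_mem_firstVisit_iff {d : ℕ} {a b : ℕ → Lattice d} (h : a 0 = b 0)
    (K : Finset (Lattice d)) :
    glueSeq a b ∈ firstVisit K 0 ↔ b 0 ∈ K ∧ ∀ n : ℕ, 1 ≤ n → a n ∉ K := by
  have h0 : glueSeq a b 0 = b 0 := glueSeq_natCast a b 0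
  rw [firstVisit, mem_ofPred_eq, h0]
  refine and_congr_right fun _ => ⟨fun hn n h1 => ?_, fun hn n h1 => ?_⟩
  · rw [← glueSeq_neg_natCast h]
    exact hn _ (by omega)
  · obtain ⟨m, rfl⟩ : ∃ m : ℕ, n = -(m : ℤ) := ⟨(-n).toNat, by omega⟩
    rw [glueSeq_neg_natCast h]
    exact hn m (by omega)

instance {d : ℕ} [NeZero d] (x : Lattice d) : IsFiniteMeasure (srw x) := by
  refine ⟨?_⟩
  rw [srw, Measure.comap_apply _ Subtype.val_injective
    (fun _ hs => (measurableSet_wPlusSet d).subtype_image hs) _ .univ]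
  exact measure_lt_top _ _

theorem measure_smul_cond {α : Type*} [MeasurableSpace α] (μ : Measure α) [IsFiniteMeasure μ]
    (s : Set α) : μ s • μ[|s] = μ.restrict s := by
  rcases eq_or_ne (μ s) 0 with h | h
  · rw [h, zero_smul, Measure.restrict_eq_zero.2 h]
  · rw [ProbabilityTheory.cond, smul_smul, ENNReal.mul_inv_cancel h (measure_ne_top _ _), one_smul]

/-- The contribution of the entrance point `x` to the measure `Q_K`. -/
theorem map_glue_apply {d : ℕ} [NeZero d] {K : Finset (Lattice d)} {x : Lattice d} (hx : x ∈ K)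
    {S : Set (ℤ → Lattice d)} (hS : MeasurableSet S) :
    (equilibrium K x • (((srw x)[|noReturn K]).prod (srw x)).map glue) (wSet d ∩ S) =
      ((walkLaw x).prod (walkLaw x))
        ((fun p => glueSeq p.1 p.2) ⁻¹' (wSet d ∩ S ∩ firstVisit K 0)) := by
  have hT : MeasurableSet (wSet d ∩ S) := (measurableSet_wSet d).inter hS
  rw [equilibrium, if_pos hx, ← Measure.map_smul, ← Measure.prod_smul_left, measure_smul_cond,
    Measure.map_apply (measurable_glue d) hT]
  nth_rewrite 2 [← Measure.restrict_univ (μ := srw x)]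
  rw [Measure.prod_restrict, Measure.restrict_apply (measurable_glue d hT)]
  let N : Set (ℕ → Lattice d) := {a | ∀ n : ℕ, 1 ≤ n → a n ∉ K}
  have hN : MeasurableSet N := by
    have : N = ⋂ n : ℕ, ⋂ (_ : 1 ≤ n), {w : ℕ → Lattice d | w n ∈ K}ᶜ := by
      ext w; simp [N]
    rw [this]
    exact MeasurableSet.iInter fun n => MeasurableSet.iInter fun _ =>
      (measurable_pi_apply n K.measurableSet).compl
  let T : Set ((ℕ → Lattice d) × (ℕ → Lattice d)) :=
    (fun p => glueSeq p.1 p.2) ⁻¹' (wSet d ∩ S) ∩ N ×ˢ univ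
  have hTm : MeasurableSet T := (measurable_glueSeq d hT).inter (hN.prod .univ)
  have hmap : ((srw x).prod (srw x)).map (Prod.map Subtype.val Subtype.val) =
      ((walkLaw x).prod (walkLaw x)).restrict (wPlusSet d ×ˢ wPlusSet d) := by
    rw [← Measure.map_prod_map _ _ measurable_subtype_coe measurable_subtype_coe, srw,
      map_comap_subtype_coe (measurableSet_wPlusSet d), Measure.prod_restrict]
  have hpre : (glue ⁻¹' (wSet d ∩ S) ∩ noReturn K ×ˢ univ : Set (WPlus d × WPlus d)) =
      Prod.map Subtype.val Subtype.val ⁻¹' T := rfl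
  rw [hpre, ← Measure.map_apply (measurable_subtype_coe.prodMap measurable_subtype_coe) hTm, hmap,
    Measure.restrict_apply hTm]
  refine measure_congr ?_
  have h1 : ∀ᵐ p ∂(walkLaw x).prod (walkLaw x), p.1 0 = x :=
    Measure.quasiMeasurePreserving_fst.ae (ae_walkLaw_zero x)
  have h2 : ∀ᵐ p ∂(walkLaw x).prod (walkLaw x), p.2 0 = x :=
    Measure.quasiMeasurePreserving_snd.ae (ae_walkLaw_zero x)
  rw [eventuallyEq_set]
  filter_upwards [h1, h2] with p hp1 hp2
  have h := hp1.trans hp2.symm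
  simp only [T, N, mem_inter_iff, mem_preimage, mem_prod, glueSeq_mem_wSet_iff h,
    glueSeq_mem_firstVisit_iff h, hp2, hx, mem_ofPred_eq, mem_univ]
  tauto

/-- The measure `Q_K` is the restriction of the two-sided walk to the transient trajectories
visiting `K` for the first time at time zero. -/
theorem entranceMeasure_apply {d : ℕ} [NeZero d] (K : Finset (Lattice d)) {B : Set (W d)}
    (hB : MeasurableSet B) :
    entranceMeasure K B = twoSidedLaw d (Subtype.val '' B ∩ firstVisit K 0) := by
  obtain ⟨S, hS, rfl⟩ := hB
  rw [entranceMeasure, Measure.comap_apply _ Subtype.val_injective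
    (fun _ hs => (measurableSet_wSet d).subtype_image hs) _ (measurable_subtype_coe hS),
    Subtype.image_preimage_coe, Measure.finsetSum_apply,
    Finset.sum_congr rfl fun x hx => map_glue_apply hx hS, twoSidedLaw_apply
      (((measurableSet_wSet d).inter hS).inter (measurableSet_firstVisit K 0)), tsum_eq_sum]
  intro x hx
  rw [← nonpos_iff_eq_zero]
  have h0 : ∀ᵐ p ∂(walkLaw x).prod (walkLaw x), p.2 0 = x :=
    Measure.quasiMeasurePreserving_snd.ae (ae_walkLaw_zero x)
  refine (measure_mono fun p hp => ?_).trans_eq (ae_iff.1 h0)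
  intro h
  exact hx (by simpa [glueSeq, h] using hp.2.1)

/-- The set of transient trajectories whose class modulo time shift belongs to `D`. -/
def trajectories {d : ℕ} (D : Set (WStar d)) : Set (ℤ → Lattice d) :=
  Subtype.val '' (proj ⁻¹' D)

theorem measurableSet_trajectories_of {d : ℕ} {D : Set (WStar d)} (hD : MeasurableSet D) :
    MeasurableSet (trajectories D) :=
  (measurableSet_wSet d).subtype_image (measurable_proj d hD)

theorem trajectories_subset {d : ℕ} (D : Set (WStar d)) : trajectories D ⊆ wSet d := by
  rintro _ ⟨w, _, rfl⟩
  exact w.2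

theorem timeShift_mem_wSet {d : ℕ} (k : ℤ) {w : ℤ → Lattice d} (hw : w ∈ wSet d) :
    timeShift k w ∈ wSet d := by
  refine ⟨fun n => ?_, hw.2.comp (add_left_injective k).tendsto_cofinite⟩
  have := hw.1 (n + k)
  rwa [add_right_comm] at this

theorem preimage_timeShift_trajectories {d : ℕ} (D : Set (WStar d)) (k : ℤ) :
    timeShift k ⁻¹' trajectories D = trajectories D := by
  have key : ∀ k (w : ℤ → Lattice d), w ∈ trajectories D → timeShift k w ∈ trajectories D := by
    rintro k _ ⟨w, hw, rfl⟩
    refine ⟨⟨timeShift k w.1, timeShift_mem_wSet k w.2⟩, ?_, rfl⟩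
    have : proj ⟨timeShift k w.1, timeShift_mem_wSet k w.2⟩ = proj w :=
      Quotient.sound ⟨k, fun n => rfl⟩
    rwa [mem_preimage, this]
  ext w
  refine ⟨fun h => ?_, key k w⟩
  have := key (-k) _ h
  have e : timeShift (-k) (timeShift k w) = w := by
    funext n; simp [timeShift]
  rwa [e] at this

theorem map_proj_entranceMeasure_apply {d : ℕ} [NeZero d] (K : Finset (Lattice d))
    {D : Set (WStar d)} (hD : MeasurableSet D) :
    (entranceMeasure K).map proj D = twoSidedLaw d (trajectories D ∩ firstVisit K 0) := by
  rw [Measure.map_apply (measurable_proj d) hD, entranceMeasure_apply K (measurable_proj d hD)]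
  rfl

theorem proj_mem_wStarHit {d : ℕ} (K : Finset (Lattice d)) (w : W d) :
    proj w ∈ wStarHit K ↔ ∃ n, w.1 n ∈ K := by
  constructor
  · rintro ⟨w', ⟨n, hn⟩, h⟩
    obtain ⟨k, hk⟩ := Quotient.exact h
    exact ⟨n + k, by rwa [← hk]⟩
  · exact fun h => ⟨w, h, rfl⟩

theorem measurableSet_wStarHit {d : ℕ} (K : Finset (Lattice d)) :
    MeasurableSet (wStarHit K) := by
  change MeasurableSet (proj ⁻¹' wStarHit K)
  have : proj ⁻¹' wStarHit K = Subtype.val ⁻¹' {w : ℤ → Lattice d | ∃ n, w n ∈ K} := by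
    ext w; exact proj_mem_wStarHit K w
  rw [this]
  exact measurable_subtype_coe (measurableSet_hits K)

theorem trajectories_inter_wStarHit {d : ℕ} (D : Set (WStar d)) (K : Finset (Lattice d)) :
    trajectories (D ∩ wStarHit K) = trajectories D ∩ {w | ∃ n, w n ∈ K} := by
  ext w
  constructor
  · rintro ⟨w, ⟨h1, h2⟩, rfl⟩
    exact ⟨⟨w, h1, rfl⟩, (proj_mem_wStarHit K w).1 h2⟩
  · rintro ⟨⟨w, h1, rfl⟩, h2⟩
    exact ⟨w, ⟨h1, (proj_mem_wStarHit K w).2 h2⟩, rfl⟩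

/-- Consistency of the measures `Q_K` modulo time shift. -/
theorem map_proj_entranceMeasure_inter {d : ℕ} [NeZero d] {K L : Finset (Lattice d)} (hKL : K ⊆ L)
    {D : Set (WStar d)} (hD : MeasurableSet D) :
    (entranceMeasure L).map proj (D ∩ wStarHit K) = (entranceMeasure K).map proj D := by
  rw [map_proj_entranceMeasure_apply L (hD.inter (measurableSet_wStarHit K)),
    map_proj_entranceMeasure_apply K hD, trajectories_inter_wStarHit,
    measure_inter_firstVisit_of_subset (measurableSet_trajectories_of hD) (trajectories_subset D)
      (preimage_timeShift_trajectories D) hKL]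

/-- On the trajectories visiting `K`, the intensity measure is the image of `Q_K`. -/
theorem intensity_inter_wStarHit {d : ℕ} [NeZero d] (K : Finset (Lattice d))
    {D : Set (WStar d)} (hD : MeasurableSet D) :
    intensity d (D ∩ wStarHit K) = twoSidedLaw d (trajectories D ∩ firstVisit K 0) := by
  classical
  rw [← map_proj_entranceMeasure_apply K hD]
  have hle : ∀ L : Finset (Lattice d), (entranceMeasure L).map proj ≤ intensity d :=
    le_iSup fun L : Finset (Lattice d) => (entranceMeasure L).map proj
  refine le_antisymm ?_ ?_
  -- A measure dominating all the images of the `Q_L` dominates their supremum.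
  · have hρ : intensity d ≤
        (intensity d).restrict (wStarHit K)ᶜ + (entranceMeasure K).map proj := by
      refine iSup_le fun L => Measure.le_iff.2 fun E hE => ?_
      calc (entranceMeasure L).map proj E
          = (entranceMeasure (L ∪ K)).map proj (E ∩ wStarHit L) :=
            (map_proj_entranceMeasure_inter Finset.subset_union_left hE).symm
        _ ≤ (entranceMeasure (L ∪ K)).map proj E := measure_mono inter_subset_left
        _ = (entranceMeasure (L ∪ K)).map proj (E ∩ (wStarHit K)ᶜ) +
            (entranceMeasure (L ∪ K)).map proj (E ∩ wStarHit K) := by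
            rw [add_comm, ← sdiff_eq, measure_inter_add_sdiff _ (measurableSet_wStarHit K)]
        _ ≤ intensity d (E ∩ (wStarHit K)ᶜ) + (entranceMeasure K).map proj E :=
            add_le_add (hle _ _)
              (map_proj_entranceMeasure_inter Finset.subset_union_right hE).le
        _ = _ := by rw [Measure.add_apply, Measure.restrict_apply hE]
    refine (hρ _).trans_eq ?_
    rw [Measure.add_apply, Measure.restrict_apply (hD.inter (measurableSet_wStarHit K)),
      inter_assoc, inter_compl_self, inter_empty, measure_empty, zero_add,
      map_proj_entranceMeasure_inter subset_rfl hD]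
  · rw [← map_proj_entranceMeasure_inter subset_rfl hD]
    exact hle K _

theorem trajectories_univ (d : ℕ) : trajectories (univ : Set (WStar d)) = wSet d := by
  simp [trajectories]

theorem intensity_wStarHit {d : ℕ} [NeZero d] (K : Finset (Lattice d)) :
    intensity d (wStarHit K) = twoSidedLaw d (wSet d ∩ firstVisit K 0) := by
  have := intensity_inter_wStarHit K (D := univ) .univ
  rwa [univ_inter, trajectories_univ] at this

theorem intensity_wStarHit_ne_top {d : ℕ} [NeZero d] (K : Finset (Lattice d)) :
    intensity d (wStarHit K) ≠ ∞ := by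
  rw [intensity_wStarHit]
  exact ((measure_mono fun w hw => hw.2.1).trans_lt (twoSidedLaw_zero_mem_lt_top K)).ne

/-- The capacity of a finite set, which is the intensity of the trajectories visiting it, is
invariant under translations. -/
theorem intensity_wStarHit_translate {d : ℕ} [NeZero d] (K : Finset (Lattice d)) (z : Lattice d) :
    intensity d (wStarHit (K.map (addRightEmbedding z))) = intensity d (wStarHit K) := by
  rw [intensity_wStarHit, intensity_wStarHit, ← measure_preimage_translate z
    ((measurableSet_wSet d).inter (measurableSet_firstVisit _ 0))]
  congr 1
  ext w
  have h1 : (fun n => w n + z) ∈ wSet d ↔ w ∈ wSet d := by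
    refine and_congr ?_ ?_
    · simp [IsNeighbor]
    · refine ⟨fun h => ?_, fun h => (add_left_injective z).tendsto_cofinite.comp h⟩
      simpa [Function.comp_def] using (add_left_injective (-z)).tendsto_cofinite.comp h
  simp [h1, firstVisit]

/-- Few trajectories visit two finite sets which are far away from each other. -/
theorem tendsto_intensity_inter {d : ℕ} [NeZero d] (hd : 3 ≤ d) (K L : Finset (Lattice d)) :
    Tendsto (fun z : Lattice d =>
      intensity d (wStarHit (L.map (addRightEmbedding z)) ∩ wStarHit K)) cofinite (nhds 0) := by
  have hlim : Tendsto (fun z : Lattice d => ∑ x ∈ K, ∑ y ∈ L,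
      2 * walkLaw x {w | ∃ n, w n = y + z}) cofinite (nhds 0) := by
    have : (0 : ℝ≥0∞) = ∑ x ∈ K, ∑ y ∈ L, 2 * 0 := by simp
    rw [this]
    exact tendsto_finsetSum _ fun x _ => tendsto_finsetSum _ fun y _ =>
      ENNReal.Tendsto.const_mul (tendsto_walkLaw_hit hd x y) (.inr (by simp))
  refine tendsto_of_tendsto_of_tendsto_of_le_of_le tendsto_const_nhds hlim (fun _ => zero_le)
    fun z => ?_
  have hD := measurableSet_wStarHit (L.map (addRightEmbedding z))
  change intensity d _ ≤ _
  rw [intensity_inter_wStarHit K hD]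
  refine (measure_mono (inter_subset_inter (fun w hw => ?_) fun w hw => hw.1)).trans
    ((twoSidedLaw_hits_le K (L.map (addRightEmbedding z))).trans_eq ?_)
  · obtain ⟨w, hw, rfl⟩ := hw
    exact (proj_mem_wStarHit _ w).1 hw
  · refine Finset.sum_congr rfl fun x _ => ?_
    rw [Finset.sum_map]
    rfl

/-! ### The law of the vacant set -/

theorem measurableEmbedding_toReal : MeasurableEmbedding NNReal.toReal :=
  NNReal.isClosedEmbedding_coe.measurableEmbedding

instance : SigmaFinite lebesgueNN := by
  refine SigmaFinite.of_map _ measurableEmbedding_toReal.measurable.aemeasurable ?_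
  rw [lebesgueNN, measurableEmbedding_toReal.map_comap]
  infer_instance

theorem lebesgueNN_Iic_ne_top (u : ℝ≥0) : lebesgueNN (Iic u) ≠ ∞ := by
  have hsub : NNReal.toReal '' Iic u ⊆ Icc 0 (u : ℝ) := by
    rintro _ ⟨t, ht, rfl⟩
    exact ⟨t.2, ht⟩
  rw [lebesgueNN, measurableEmbedding_toReal.comap_apply]
  exact ((measure_mono hsub).trans_lt (by simp)).ne

theorem mem_wStarHit_iff {d : ℕ} (K : Finset (Lattice d)) (ws : WStar d) :
    ws ∈ wStarHit K ↔ ∃ x ∈ K, x ∈ ws.range := by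
  constructor
  · rintro ⟨w, ⟨n, hn⟩, rfl⟩
    exact ⟨w.1 n, hn, w, rfl, n, rfl⟩
  · rintro ⟨_, hx, w, rfl, n, rfl⟩
    exact ⟨w, ⟨n, hx⟩, rfl⟩

theorem wStarHit_union {d : ℕ} [DecidableEq (Lattice d)] (K L : Finset (Lattice d)) :
    wStarHit (K ∪ L) = wStarHit K ∪ wStarHit L := by
  ext ws
  simp only [mem_union, mem_wStarHit_iff, Finset.mem_union]
  grind

/-- The set `K` is vacant when no trajectory with label at most `u` visits it. -/
theorem vacantConfig_mem_vacantCylinder {d : ℕ} (u : ℝ≥0) (ω : PointSpace d)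
    (K : Finset (Lattice d)) :
    vacantConfig u ω ∈ vacantCylinder K ↔ ω.1 (wStarHit K ×ˢ Iic u) = 0 := by
  obtain ⟨p, hp⟩ := ω.2.1
  have hm : MeasurableSet (wStarHit K ×ˢ Iic u) :=
    (measurableSet_wStarHit K).prod measurableSet_Iic
  have h : vacantConfig u ω ∈ vacantCylinder K ↔ ∀ z ∈ K, z ∉ interlacementSet u ω := by
    classical exact forall₂_congr fun z _ => decide_eq_true_iff
  rw [h, hp, Measure.sum_apply _ hm, ENNReal.tsum_eq_zero]
  simp only [interlacementSet_eq u ω p hp, mem_iUnion, Measure.dirac_apply' _ hm,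
    indicator_apply_eq_zero, mem_prod, mem_wStarHit_iff, Pi.one_apply, one_ne_zero, mem_Iic]
  grind

theorem measurableSet_vacantConfig_mem {d : ℕ} (u : ℝ≥0) (K : Finset (Lattice d)) :
    MeasurableSet {ω : PointSpace d | vacantConfig u ω ∈ vacantCylinder K} := by
  simp only [vacantConfig_mem_vacantCylinder]
  exact (Measure.measurable_coe ((measurableSet_wStarHit K).prod measurableSet_Iic)).comp
    measurable_subtype_coe (measurableSet_singleton 0)

theorem measurable_vacantConfig (d : ℕ) (u : ℝ≥0) :
    Measurable (vacantConfig u : PointSpace d → Config d) := by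
  refine measurable_pi_lambda (X := fun _ : Lattice d => Bool) _ fun z => measurable_to_bool ?_
  have : (fun ω : PointSpace d => vacantConfig u ω z) ⁻¹' {true} =
      {ω | vacantConfig u ω ∈ vacantCylinder {z}} := by
    ext ω; simp [vacantCylinder]
  rw [this]
  exact measurableSet_vacantConfig_mem u {z}

theorem perc_eq_preimage (d : ℕ) (u : ℝ≥0) : perc d u = vacantConfig u ⁻¹' percConfig d := by
  ext ω
  have : {z | vacantConfig u ω z = true} = vacantSet u ω := by
    ext z; simp [vacantConfig]
  change _ ↔ ∃ C : ((latticeGraph d).induce {z | vacantConfig u ω z = true}).ConnectedComponent,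
    C.supp.Infinite
  rw [this]
  rfl

/-- The probability that `K` is vacant is the exponential of minus `u` times the capacity; here `u`
appears as the Lebesgue measure of the interval `[0, u]`. -/
theorem vacantLaw_real_vacantCylinder {d : ℕ} [NeZero d] {P : Measure (PointSpace d)}
    (hP : IsInterlacementLaw P) (u : ℝ≥0) (K : Finset (Lattice d)) :
    (vacantLaw P u).real (vacantCylinder K) =
      Real.exp (-((intensity d (wStarHit K)).toReal * (lebesgueNN (Iic u)).toReal)) := by
  have hm : MeasurableSet (wStarHit K ×ˢ Iic u) :=
    (measurableSet_wStarHit K).prod measurableSet_Iic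
  have hN : Measurable fun ω : PointSpace d => ω.1 (wStarHit K ×ˢ Iic u) :=
    (Measure.measurable_coe hm).comp measurable_subtype_coe
  have hpois := hP.poisson _ hm (by
    rw [Measure.prod_prod]
    exact ENNReal.mul_ne_top (intensity_wStarHit_ne_top K) (lebesgueNN_Iic_ne_top u))
  have h0 := congrArg (fun μ => μ {0}) hpois
  have hpre : (fun k : ℕ => (k : ℝ≥0∞)) ⁻¹' {0} = {0} := by ext; simp
  rw [Measure.map_apply hN (measurableSet_singleton 0),
    Measure.map_apply (measurable_of_countable _) (measurableSet_singleton 0), hpre,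
    poissonMeasure_singleton] at h0
  have hpre' : vacantConfig u ⁻¹' vacantCylinder K =
      (fun ω : PointSpace d => ω.1 (wStarHit K ×ˢ Iic u)) ⁻¹' {0} := by
    ext ω; exact vacantConfig_mem_vacantCylinder u ω K
  rw [vacantLaw, map_measureReal_apply (measurable_vacantConfig d u)
    (measurableSet_vacantCylinder K), measureReal_def, hpre', h0, Measure.prod_prod,
    ENNReal.toReal_ofReal (by positivity)]
  rw [pow_zero, mul_one, Nat.factorial_zero, Nat.cast_one, div_one,
    ENNReal.coe_toNNReal_eq_toReal, ENNReal.toReal_mul]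

end Interlacement

open Interlacement in
theorem theorem2p1 (d : ℕ) [NeZero d] (hd : 3 ≤ d)
    (P : Measure (PointSpace d)) (hP : IsInterlacementLaw P) (u : ℝ≥0) :
    (Measurable (vacantConfig u : PointSpace d → Config d) ∧
      (∀ x : Lattice d, MeasurePreserving (fun y : Config d => x +ᵥ y)
        (vacantLaw P u) (vacantLaw P u)) ∧
      ErgodicVAdd (Lattice d) (Config d) (vacantLaw P u)) ∧
    (MeasurableSet (perc d u) ∧ (P (perc d u) = 0 ∨ P (perc d u) = 1)) := by
  classical
  have hmeas := measurable_vacantConfig d u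
  have hprobP := hP.isProbabilityMeasure
  have hprob : IsProbabilityMeasure (vacantLaw P u) :=
    Measure.isProbabilityMeasure_map hmeas.aemeasurable
  have hinv : ∀ x : Lattice d, MeasurePreserving (fun y : Config d => x +ᵥ y)
      (vacantLaw P u) (vacantLaw P u) := fun x =>
    measurePreserving_vadd_of_vacantCylinder x fun K => by
      rw [← measureReal_eq_measureReal_iff, vacantLaw_real_vacantCylinder hP,
        vacantLaw_real_vacantCylinder hP, intensity_wStarHit_translate]
  have herg : ErgodicVAdd (Lattice d) (Config d) (vacantLaw P u) := by
    refine ergodicVAdd_of_vacantCylinder hinv fun K L => ?_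
    have e : ∀ z : Lattice d, (vacantLaw P u).real
        (vacantCylinder (L.map (addRightEmbedding z)) ∩ vacantCylinder K) =
        (vacantLaw P u).real (vacantCylinder L) * (vacantLaw P u).real (vacantCylinder K) *
          Real.exp ((intensity d (wStarHit (L.map (addRightEmbedding z)) ∩ wStarHit K)).toReal *
            (lebesgueNN (Iic u)).toReal) := by
      intro z
      have hfin := intensity_wStarHit_ne_top (d := d)
      have hunion := measure_union_add_inter (μ := intensity d)
        (wStarHit (L.map (addRightEmbedding z))) (measurableSet_wStarHit K)
      rw [← wStarHit_union, intensity_wStarHit_translate] at hunion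
      have hreal := congrArg ENNReal.toReal hunion
      rw [ENNReal.toReal_add (hfin _) (measure_ne_top_of_subset inter_subset_right (hfin K)),
        ENNReal.toReal_add (hfin L) (hfin K)] at hreal
      rw [vacantCylinder_inter, vacantLaw_real_vacantCylinder hP, vacantLaw_real_vacantCylinder hP,
        vacantLaw_real_vacantCylinder hP, ← Real.exp_add, ← Real.exp_add,
        eq_sub_of_add_eq hreal]
      congr 1
      ring
    have hlim := (ENNReal.tendsto_toReal ENNReal.zero_ne_top).comp (tendsto_intensity_inter hd K L)
    have hexp := (Real.continuous_exp.tendsto _).comp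
      (hlim.mul_const (lebesgueNN (Iic u)).toReal)
    have := hexp.const_mul
      ((vacantLaw P u).real (vacantCylinder L) * (vacantLaw P u).real (vacantCylinder K))
    simp only [ENNReal.toReal_zero, zero_mul, Real.exp_zero, mul_one] at this
    simp_rw [e]
    exact this
  refine ⟨⟨hmeas, hinv, herg⟩, ?_, ?_⟩
  · rw [perc_eq_preimage]
    exact hmeas (measurableSet_percConfig d)
  · have hconst := herg.aeconst_of_forall_preimage_vadd_ae_eq (measurableSet_percConfig d)
      fun v => .of_eq (preimage_vadd_percConfig v)
    rw [perc_eq_preimage, ← Measure.map_apply hmeas (measurableSet_percConfig d)]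
    change vacantLaw P u _ = 0 ∨ vacantLaw P u _ = 1
    rw [eventuallyConst_set'] at hconst
    exact hconst.imp ae_eq_empty.1 fun h => by rw [measure_congr h, measure_univ]
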